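/- **Setting.** For $n\ge 1$ let $S(2n)$ be the group of permutations of $\{-n,\dots,-1,1,\dots,n\}$, $H(n)\subset S(2n)$ the centralizer of $\breve t=(-n\,n)\cdots(-1\,1)$, and $S(2\infty)=\bigcup_n S(2n)$. Let $X(n)=H(n)\backslash S(2n)$, realized as the set of partitions of $\{-n,\dots,-1,1,\dots,n\}$ into $n$ unordered pairs, with the right action of $g\in S(2n)$ that replaces each pair $\{i,j\}$ by $\{g(i),g(j)\}$ (permutations being multiplied from left to right). For $x\in X(n)$ let $[x]_n$ be the number of cycles of $x$, i.e. of classes of the equivalence relation on $\{-n,\dots,-1,1,\dots,n\}$ generated by $i\sim -i$ and $i\sim j$ for $\{i,j\}\in x$. Let $p_{n,n+1}:X(n+1)\to X(n)$ delete the pair $\{n+1,-n-1\}$ if it is present and otherwise replace $\{i,-n-1\},\{k,n+1\}$ by $\{i,k\}$; let $X=\varprojlim X(n)$, with projections $p_n:X\to X(n)$. The group $S(2\infty)$ acts on $X$ from the right by $p_n(x\cdot g)=p_n(x)\cdot g$ for $n$ large, and $c(x;g)=[p_n(x)\cdot g]_n-[p_n(x)]_n$ does not depend on $n$ when $g\in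 S(2n)$. For $t>0$ let $\mu_t$ be the probability measure on $X$ with $\mu_t(p_n^{-1}(x))=\dfrac{t^{[x]_n}}{t(t+2)\cdots(t+2n-2)}$ for all $n$ and $x\in X(n)$. For $z\in\mathbb C\setminus\{0\}$ and $t=|z|^2$ let $T_{z,1/2}$ be the unitary representation of $S(2\infty)$ in $L^2(X,\mu_t)$ given by $(T_{z,1/2}(g)f)(x)=z^{c(x;g)}f(x\cdot g)$, and let $$\varphi_z(g)=\bigl(T_{z,1/2}(g)\mathbf 1,\mathbf 1\bigr)_{L^2(X,\mu_t)},\qquad g\in S(2\infty),$$ be its spherical function, the matrix coefficient of the constant function $\mathbf 1$ (a unit vector invariant under $\bigcup_n H(n)$). For a Young diagram $\lambda$ with $n$ boxes let $\chi^{2\lambda}$ be the irreducible character of $S(2n)$ labelled by $2\lambda=(2\lambda_1,2\lambda_2,\dots)$, $\dim 2\lambda=\chi^{2\lambda}(e)$, and let $$w^\lambda(g)=\frac1{|H(n)|}\sum_{h\in H(n)}\chi^{2\lambda}(gh),\qquad g\in S(2n),$$ be the zonal spherical function of $(S(2n),H(n))$, also viewed as a function on $X(n)=H(n)\backslash S(2n)$.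 Let $$F_z^{(n)}(x)=\left(\frac{1\cdot3\cdots(2n-1)}{t(t+2)\cdots(t+2n-2)}\right)^{1/2}z^{[x]_n}\quad(x\in X(n)),\qquad M^{(n)}_{z,1/2}(\lambda)=\left|\bigl(F_z^{(n)},(\dim 2\lambda)^{1/2}w^\lambda\bigr)\right|^2,$$ with the inner product $(f_1,f_2)=\frac1{|X(n)|}\sum_{x\in X(n)}f_1(x)\overline{f_2(x)}$. **Proposition and corollary.** For every nonzero $z\in\mathbb C$ and every $n$, $$\varphi_z(g)=\sum_{|\lambda|=n}M^{(n)}_{z,1/2}(\lambda)\,w^\lambda(g)\qquad\text{for all } g\in S(2n).$$ Moreover $M^{(n)}_{z,1/2}(\lambda)\ge0$ and $\sum_{|\lambda|=n}M^{(n)}_{z,1/2}(\lambda)=1$, so that $M^{(n)}_{z,1/2}$ is a probability measure on the set $\mathbb Y_n$ of Young diagrams with $n$ boxes. -/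

import Mathlib

open MeasureTheory Equiv

noncomputable section

namespace GelfandZ

/-- The `2n` symbols `-n, …, -1, 1, …, n`. -/
def letters (n : ℕ) : Finset ℤ := (Finset.Icc (-(n : ℤ)) n).erase 0

/-- The set `{-n, …, -1, 1, …, n}` as a type; the group `S(2n)` is `Perm (Letters n)`. -/
abbrev Letters (n : ℕ) : Type := {k : ℤ // k ∈ letters n}

theorem mem_letters {n : ℕ} {k : ℤ} : k ∈ letters n ↔ k ≠ 0 ∧ -(n : ℤ) ≤ k ∧ k ≤ n := by
  simp [letters]

theorem letters_mono {m n : ℕ} (h : m ≤ n) : letters m ⊆ letters n := by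
  intro k hk
  rw [mem_letters] at hk ⊢
  omega

theorem neg_mem_letters {n : ℕ} {k : ℤ} (h : k ∈ letters n) : -k ∈ letters n := by
  rw [mem_letters] at h ⊢
  omega

/-- The element `t̆ ∈ S(2n)`, the product of the transpositions `(-n, n), …, (-1, 1)`. -/
def flip (n : ℕ) : Perm (Letters n) where
  toFun i := ⟨-i.1, neg_mem_letters i.2⟩
  invFun i := ⟨-i.1, neg_mem_letters i.2⟩
  left_inv i := Subtype.ext (neg_neg i.1)
  right_inv i := Subtype.ext (neg_neg i.1)

theorem flip_flip {n : ℕ} (i : Letters n) : flip n (flip n i) = i := (flip n).left_inv i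

theorem flip_ne {n : ℕ} (i : Letters n) : flip n i ≠ i := by
  intro h
  have h1 : -i.1 = i.1 := congrArg Subtype.val h
  have h2 := (mem_letters.1 i.2).1
  omega

/-- The hyperoctahedral group `H(n)`, the centralizer of `t̆` in `S(2n)`. -/
def hyperoctahedral (n : ℕ) : Subgroup (Perm (Letters n)) := Subgroup.centralizer {flip n}

/-- An element of `X(n)`: a partition of `{-n, …, -1, 1, …, n}` into `n` unordered pairs
`{i, partner i}`. -/
@[ext] structure Pairing (n : ℕ) where
  partner : Letters n → Letters n
  partner_partner : ∀ i, partner (partner i) = i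
  partner_ne : ∀ i, partner i ≠ i

instance (n : ℕ) : Fintype (Pairing n) :=
  Fintype.ofInjective Pairing.partner fun _ _ h => Pairing.ext h

instance (n : ℕ) : MeasurableSpace (Pairing n) := ⊤

instance (n : ℕ) : DiscreteMeasurableSpace (Pairing n) := ⟨fun _ => trivial⟩

/-- A permutation `g` sends the pairing with the pairs `{i, j}` to the one with the pairs
`{g i, g j}`.  This is the right action `x ↦ x · g` of `S(2n)` for permutations multiplied from
left to right; with Lean's product of permutations it is a left action, written `g • x`. -/
instance (n : ℕ) : MulAction (Perm (Letters n)) (Pairing n) where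
  smul g x :=
    { partner := fun i => g (x.partner (g⁻¹ i))
      partner_partner := fun i => by simp [x.partner_partner]
      partner_ne := fun i h => x.partner_ne (g⁻¹ i) (by
        have := congrArg (g⁻¹ : Perm (Letters n)) h
        simpa using this) }
  one_smul _ := rfl
  mul_smul _ _ _ := rfl

theorem smul_partner {n : ℕ} (g : Perm (Letters n)) (x : Pairing n) (i : Letters n) :
    (g • x).partner i = g (x.partner (g⁻¹ i)) := rfl

theorem smul_partner' {n : ℕ} (g : Perm (Letters n)) (x : Pairing n) (i : Letters n) :
    (g • x).partner (g i) = g (x.partner i) := by simp [smul_partner]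

/-- The pairing `{{-n, n}, …, {-1, 1}}`; its stabilizer is `H(n)`, so `X(n) = H(n) \ S(2n)`. -/
def basePairing (n : ℕ) : Pairing n := ⟨flip n, flip_flip, flip_ne⟩

/-- The two kinds of steps `i → partner i` and `i → -i` along the cycles of a pairing. -/
def Pairing.step {n : ℕ} (x : Pairing n) (i j : Letters n) : Prop :=
  j = x.partner i ∨ j = flip n i

/-- The number `[x]ₙ` of cycles `j₁ → -j₂ → j₂ → -j₃ → ⋯ → -j₁ → j₁` of a pairing, i.e. of classes
of the equivalence relation generated by the steps. -/
def Pairing.circles {n : ℕ} (x : Pairing n) : ℕ := Nat.card (Quot x.step)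

/-! ### Deleting and inserting the symbols `±(n+1)` -/

/-- The inclusion of `{-n, …, n}` into `{-n-1, …, n+1}`. -/
def incl {n : ℕ} (i : Letters n) : Letters (n + 1) := ⟨i.1, letters_mono n.le_succ i.2⟩

/-- The symbol `n + 1`. -/
def top (n : ℕ) : Letters (n + 1) := ⟨(n : ℤ) + 1, by rw [mem_letters]; push_cast; omega⟩

theorem incl_injective {n : ℕ} : Function.Injective (incl : Letters n → Letters (n + 1)) :=
  fun _ _ h => Subtype.ext (Subtype.mk.inj h)

theorem incl_ne_top {n : ℕ} (i : Letters n) : incl i ≠ top n := by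
  intro h
  have h1 : i.1 = (n : ℤ) + 1 := congrArg Subtype.val h
  have h2 := mem_letters.1 i.2
  omega

theorem flip_incl {n : ℕ} (i : Letters n) : flip (n + 1) (incl i) = incl (flip n i) := rfl

theorem incl_ne_bot {n : ℕ} (i : Letters n) : incl i ≠ flip (n + 1) (top n) := by
  intro h
  apply incl_ne_top (flip n i)
  rw [← flip_incl, h, flip_flip]

theorem letters_cases {n : ℕ} (k : Letters (n + 1)) :
    (∃ i, k = incl i) ∨ k = top n ∨ k = flip (n + 1) (top n) := by
  by_cases h : k.1 ∈ letters n
  · exact Or.inl ⟨⟨k.1, h⟩, rfl⟩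
  · right
    have h1 := mem_letters.1 k.2
    rw [mem_letters] at h
    push_cast at h1
    by_cases h2 : k.1 = (n : ℤ) + 1
    · exact Or.inl (Subtype.ext h2)
    · refine Or.inr (Subtype.ext ?_)
      change k.1 = -((n : ℤ) + 1)
      omega

theorem not_mem_iff {n : ℕ} (k : Letters (n + 1)) :
    k.1 ∉ letters n ↔ k = top n ∨ k = flip (n + 1) (top n) := by
  constructor
  · intro h
    rcases letters_cases k with ⟨i, rfl⟩ | h'
    · exact absurd i.2 h
    · exact h'
  · rintro h hk
    rcases h with rfl | rfl
    · exact incl_ne_top ⟨_, hk⟩ rfl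
    · exact incl_ne_bot ⟨_, hk⟩ rfl

theorem proj_aux {n : ℕ} (x : Pairing (n + 1)) (i : Letters n)
    (h : (x.partner (incl i)).1 ∉ letters n) :
    (x.partner (flip (n + 1) (x.partner (incl i)))).1 ∈ letters n := by
  by_contra h'
  rw [not_mem_iff] at h h'
  have h1 := x.partner_partner (incl i)
  have h3 := x.partner_ne (top n)
  have h4 := x.partner_ne (flip (n + 1) (top n))
  have h5 := incl_ne_top i
  have h6 := incl_ne_bot i
  have h7 := x.partner_partner (top n)
  have h8 := x.partner_partner (flip (n + 1) (top n))
  rcases h with h | h <;> rw [h] at h' h1 <;> (try rw [flip_flip] at h') <;>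
    rcases h' with h' | h' <;> grind

/-- The partner of `i` in the derivative of a pairing `x`: the partner of `i` in `x`, except that
if this is `±(n+1)` one takes the partner of `∓(n+1)`. -/
def projFun {n : ℕ} (x : Pairing (n + 1)) (i : Letters n) : Letters n := by
  classical
  exact if h : (x.partner (incl i)).1 ∈ letters n then ⟨(x.partner (incl i)).1, h⟩
    else ⟨(x.partner (flip (n + 1) (x.partner (incl i)))).1, proj_aux x i h⟩

theorem projFun_in {n : ℕ} {x : Pairing (n + 1)} {i j : Letters n}
    (h : x.partner (incl i) = incl j) : projFun x i = j := by
  have h' : (x.partner (incl i)).1 ∈ letters n := by rw [h]; exact j.2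
  unfold projFun
  rw [dif_pos h']
  apply incl_injective
  rw [← h]; rfl

theorem projFun_out {n : ℕ} {x : Pairing (n + 1)} {i j : Letters n} {k : Letters (n + 1)}
    (hk : k = top n ∨ k = flip (n + 1) (top n))
    (h : x.partner (incl i) = k) (h2 : x.partner (flip (n + 1) k) = incl j) :
    projFun x i = j := by
  have h' : (x.partner (incl i)).1 ∉ letters n := by rw [h, not_mem_iff]; exact hk
  unfold projFun
  rw [dif_neg h']
  apply incl_injective
  rw [← h2, ← h]; rfl

theorem projFun_cases {n : ℕ} (x : Pairing (n + 1)) (i : Letters n) :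
    x.partner (incl i) = incl (projFun x i) ∨
    ∃ k, (k = top n ∨ k = flip (n + 1) (top n)) ∧ x.partner (incl i) = k ∧
      x.partner (flip (n + 1) k) = incl (projFun x i) := by
  by_cases h : (x.partner (incl i)).1 ∈ letters n
  · left
    have : x.partner (incl i) = incl ⟨_, h⟩ := rfl
    rw [projFun_in this]; rfl
  · right
    refine ⟨_, (not_mem_iff _).1 h, rfl, ?_⟩
    have h2 : x.partner (flip (n + 1) (x.partner (incl i))) = incl ⟨_, proj_aux x i h⟩ := rfl
    rw [projFun_out ((not_mem_iff _).1 h) rfl h2]; rfl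

theorem flip_out {n : ℕ} {k : Letters (n + 1)} (hk : k = top n ∨ k = flip (n + 1) (top n)) :
    flip (n + 1) k = top n ∨ flip (n + 1) k = flip (n + 1) (top n) := by
  rcases hk with rfl | rfl
  · exact Or.inr rfl
  · exact Or.inl (flip_flip _)

/-- The canonical projection `p_{n,n+1} : X(n+1) → X(n)`: a pair `{-n-1, n+1}` is deleted, and two
pairs `{i, -n-1}`, `{k, n+1}` are replaced by `{i, k}`. -/
def proj {n : ℕ} (x : Pairing (n + 1)) : Pairing n where
  partner := projFun x
  partner_partner i := by
    rcases projFun_cases x i with h | ⟨k, hk, h1, h2⟩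
    · apply projFun_in
      rw [← h, x.partner_partner]
    · refine projFun_out (flip_out hk) ?_ ?_
      · rw [← h2, x.partner_partner]
      · rw [flip_flip, ← h1, x.partner_partner]
  partner_ne i h := by
    rcases projFun_cases x i with h' | ⟨k, hk, h1, h2⟩
    · rw [h] at h'; exact x.partner_ne _ h'
    · rw [h, ← h1] at h2
      have := congrArg x.partner h2
      rw [x.partner_partner, h1] at this
      exact flip_ne k this

theorem proj_in {n : ℕ} {x : Pairing (n + 1)} {i j : Letters n}
    (h : x.partner (incl i) = incl j) : (proj x).partner i = j := projFun_in h

theorem proj_out {n : ℕ} {x : Pairing (n + 1)} {i j : Letters n} {k : Letters (n + 1)}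
    (hk : k = top n ∨ k = flip (n + 1) (top n))
    (h : x.partner (incl i) = k) (h2 : x.partner (flip (n + 1) k) = incl j) :
    (proj x).partner i = j := projFun_out hk h h2

theorem proj_cases {n : ℕ} (x : Pairing (n + 1)) (i : Letters n) :
    x.partner (incl i) = incl ((proj x).partner i) ∨
    ∃ k, (k = top n ∨ k = flip (n + 1) (top n)) ∧ x.partner (incl i) = k ∧
      x.partner (flip (n + 1) k) = incl ((proj x).partner i) := projFun_cases x i


theorem circles_proj {n : ℕ} (x : Pairing (n + 1)) :
    x.circles = (proj x).circles + if x.partner (top n) = flip (n + 1) (top n) then 1 else 0 := by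
  have sp : ∀ i, Quot.mk x.step i = Quot.mk x.step (x.partner i) :=
    fun i => Quot.sound (Or.inl rfl)
  have sf : ∀ i, Quot.mk x.step i = Quot.mk x.step (flip (n + 1) i) :=
    fun i => Quot.sound (Or.inr rfl)
  have hstep : ∀ i j, (proj x).step i j →
      Quot.mk x.step (incl i) = Quot.mk x.step (incl j) := by
    rintro i j (rfl | rfl)
    · rcases proj_cases x i with h | ⟨k, hk, h1, h2⟩
      · rw [← h]; exact Quot.sound (Or.inl rfl)
      · rw [← h2, ← sp, ← sf, ← h1, ← sp]
    · rw [← flip_incl, ← sf]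
  by_cases hp : x.partner (top n) = flip (n + 1) (top n)
  · rw [if_pos hp]
    have hp2 : x.partner (flip (n + 1) (top n)) = top n := by rw [← hp, x.partner_partner]
    have hin : ∀ i, x.partner (incl i) = incl ((proj x).partner i) := by
      intro i
      rcases proj_cases x i with h | ⟨k, hk, h1, h2⟩
      · exact h
      · exfalso
        have h3 := x.partner_partner (incl i)
        rcases hk with rfl | rfl
        · rw [h1, hp] at h3; exact incl_ne_bot i h3.symm
        · rw [h1, hp2] at h3; exact incl_ne_top i h3.symm
    classical
    let d : Letters (n + 1) → Option (Quot (proj x).step) := fun k =>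
      if h : k.1 ∈ letters n then some (Quot.mk _ ⟨k.1, h⟩) else none
    have d_incl : ∀ i : Letters n, d (incl i) = some (Quot.mk _ i) := fun i => dif_pos i.2
    have d_top : d (top n) = none := dif_neg ((not_mem_iff _).2 (Or.inl rfl))
    have d_bot : d (flip (n + 1) (top n)) = none := dif_neg ((not_mem_iff _).2 (Or.inr rfl))
    have hd : ∀ i j, x.step i j → d i = d j := by
      rintro i j (rfl | rfl)
      · rcases letters_cases i with ⟨i, rfl⟩ | rfl | rfl
        · rw [hin, d_incl, d_incl]; exact congrArg some (Quot.sound (Or.inl rfl))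
        · rw [hp, d_top, d_bot]
        · rw [hp2, d_top, d_bot]
      · rcases letters_cases i with ⟨i, rfl⟩ | rfl | rfl
        · rw [flip_incl, d_incl, d_incl]; exact congrArg some (Quot.sound (Or.inr rfl))
        · rw [d_top, d_bot]
        · rw [flip_flip, d_top, d_bot]
    let e : Quot x.step ≃ Option (Quot (proj x).step) :=
      { toFun := Quot.lift d hd
        invFun := fun o => o.elim (Quot.mk _ (top n))
          (Quot.lift (fun i => Quot.mk _ (incl i)) hstep)
        left_inv := by
          rintro ⟨i⟩
          rcases letters_cases i with ⟨i, rfl⟩ | rfl | rfl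
          · change Option.elim (d (incl i)) _ _ = _
            rw [d_incl]; rfl
          · change Option.elim (d (top n)) _ _ = _
            rw [d_top]; rfl
          · change Option.elim (d (flip (n + 1) (top n))) _ _ = _
            rw [d_bot]; exact Quot.sound (Or.inr rfl)
        right_inv := by
          rintro (_ | ⟨i⟩)
          · exact d_top
          · induction i using Quot.ind
            exact d_incl _ }
    unfold Pairing.circles
    rw [Nat.card_congr e, Finite.card_option]
  · rw [if_neg hp, add_zero]
    have hb : ∀ k : Letters (n + 1), (k = top n ∨ k = flip (n + 1) (top n)) →
        ∃ a, x.partner k = incl a := by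
      intro k hk
      rcases letters_cases (x.partner k) with h | h | h
      · exact h
      · rcases hk with rfl | rfl
        · exact absurd h (x.partner_ne _)
        · exact absurd (by
            conv_lhs => rw [← h]
            rw [x.partner_partner]) hp
      · rcases hk with rfl | rfl
        · exact absurd h hp
        · exact absurd h (x.partner_ne _)
    obtain ⟨a, ha⟩ := hb _ (Or.inl rfl)
    obtain ⟨b, hb⟩ := hb _ (Or.inr rfl)
    have ha' : x.partner (incl a) = top n := by rw [← ha, x.partner_partner]
    have hb' : x.partner (incl b) = flip (n + 1) (top n) := by rw [← hb, x.partner_partner]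
    have hab : (proj x).partner a = b := proj_out (Or.inl rfl) ha' hb
    classical
    let d : Letters (n + 1) → Quot (proj x).step := fun k =>
      if h : k.1 ∈ letters n then Quot.mk _ ⟨k.1, h⟩ else Quot.mk _ a
    have d_incl : ∀ i : Letters n, d (incl i) = Quot.mk _ i := fun i => dif_pos i.2
    have d_top : d (top n) = Quot.mk _ a := dif_neg ((not_mem_iff _).2 (Or.inl rfl))
    have d_bot : d (flip (n + 1) (top n)) = Quot.mk _ a :=
      dif_neg ((not_mem_iff _).2 (Or.inr rfl))
    have hqab : (Quot.mk _ a : Quot (proj x).step) = Quot.mk _ b := Quot.sound (Or.inl hab.symm)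
    have hd : ∀ i j, x.step i j → d i = d j := by
      rintro i j (rfl | rfl)
      · rcases letters_cases i with ⟨i, rfl⟩ | rfl | rfl
        · rcases proj_cases x i with h | ⟨k, hk, h1, h2⟩
          · rw [h, d_incl, d_incl]; exact Quot.sound (Or.inl rfl)
          · have h3 := x.partner_partner (incl i)
            rcases hk with rfl | rfl
            · rw [h1, ha] at h3
              rw [h1, d_top, d_incl, incl_injective h3]
            · rw [h1, hb] at h3
              rw [h1, d_bot, d_incl, ← incl_injective h3, hqab]
        · rw [ha, d_top, d_incl]
        · rw [hb, d_bot, d_incl, hqab]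
      · rcases letters_cases i with ⟨i, rfl⟩ | rfl | rfl
        · rw [flip_incl, d_incl, d_incl]; exact Quot.sound (Or.inr rfl)
        · rw [d_top, d_bot]
        · rw [flip_flip, d_top, d_bot]
    let e : Quot x.step ≃ Quot (proj x).step :=
      { toFun := Quot.lift d hd
        invFun := Quot.lift (fun i => Quot.mk _ (incl i)) hstep
        left_inv := by
          rintro ⟨i⟩
          have key : ∀ k : Letters (n + 1), d k = Quot.mk _ a →
              (Quot.mk x.step k = Quot.mk _ (incl a)) →
              Quot.lift (fun i => Quot.mk x.step (incl i)) hstep (d k) = Quot.mk _ k := by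
            intro k h1 h2
            rw [h1, h2]
          have htop : Quot.mk x.step (top n) = Quot.mk _ (incl a) := Quot.sound (Or.inl ha.symm)
          rcases letters_cases i with ⟨i, rfl⟩ | rfl | rfl
          · change Quot.lift _ _ (d (incl i)) = _
            rw [d_incl]
          · exact key _ d_top htop
          · exact key _ d_bot ((sf _).symm.trans htop)
        right_inv := by
          rintro ⟨i⟩
          exact d_incl i }
    exact Nat.card_congr e

/-- The way in which `{n+1, -n-1}` sits in a pairing: `none` if it is a pair, and otherwise the
partner of `n + 1`. -/
def code {n : ℕ} (x : Pairing (n + 1)) : Option (Letters n) := by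
  classical
  exact if h : (x.partner (top n)).1 ∈ letters n then some ⟨_, h⟩ else none

theorem code_eq_some {n : ℕ} {x : Pairing (n + 1)} {a : Letters n} :
    code x = some a ↔ x.partner (top n) = incl a := by
  unfold code
  split_ifs with h
  · rw [Option.some_inj]
    exact ⟨fun h' => by rw [← h']; rfl, fun h' => Subtype.ext (show (x.partner (top n)).1 = (incl a).1 by rw [h'])⟩
  · refine ⟨fun h' => (by simp at h'), fun h' => absurd ?_ h⟩
    rw [h']; exact a.2

theorem code_eq_none {n : ℕ} {x : Pairing (n + 1)} :
    code x = none ↔ x.partner (top n) = flip (n + 1) (top n) := by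
  unfold code
  split_ifs with h
  · refine ⟨fun h' => (by simp at h'), fun h' => absurd h ?_⟩
    exact (not_mem_iff _).2 (Or.inr h')
  · refine ⟨fun _ => ?_, fun _ => rfl⟩
    rcases (not_mem_iff _).1 h with h' | h'
    · exact absurd h' (x.partner_ne _)
    · exact h'

theorem ext_of_proj_code {n : ℕ} {x y : Pairing (n + 1)} (h : proj x = proj y)
    (hc : code x = code y) : x = y := by
  have key : ∀ x y : Pairing (n + 1), proj x = proj y → code x = code y →
      x.partner (top n) = y.partner (top n) ∧
      x.partner (flip (n + 1) (top n)) = y.partner (flip (n + 1) (top n)) := by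
    intro x y h hc
    rcases hx : code x with _ | a
    · have hy : code y = none := hc ▸ hx
      rw [code_eq_none] at hx hy
      refine ⟨hx.trans hy.symm, ?_⟩
      have h1 := x.partner_partner (top n)
      have h2 := y.partner_partner (top n)
      rw [hx] at h1; rw [hy] at h2
      rw [h1, h2]
    · have hy : code y = some a := hc ▸ hx
      rw [code_eq_some] at hx hy
      refine ⟨hx.trans hy.symm, ?_⟩
      have aux : ∀ w : Pairing (n + 1), w.partner (top n) = incl a →
          w.partner (flip (n + 1) (top n)) = incl ((proj w).partner a) := by
        intro w hw
        have hw' : w.partner (incl a) = top n := by rw [← hw, w.partner_partner]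
        rcases proj_cases w a with h1 | ⟨k, hk, h1, h2⟩
        · rw [hw'] at h1; exact absurd h1.symm (incl_ne_top _)
        · rw [hw'] at h1; subst h1; exact h2
      rw [aux x hx, aux y hy, h]
  obtain ⟨h1, h2⟩ := key x y h hc
  apply Pairing.ext
  funext k
  rcases letters_cases k with ⟨i, rfl⟩ | rfl | rfl
  · have aux : ∀ w v : Pairing (n + 1), w.partner (top n) = v.partner (top n) →
        w.partner (flip (n + 1) (top n)) = v.partner (flip (n + 1) (top n)) →
        ∀ k, (k = top n ∨ k = flip (n + 1) (top n)) → w.partner (incl i) = k →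
          w.partner (incl i) = v.partner (incl i) := by
      intro w v e1 e2 k hk hw
      have h3 : w.partner k = v.partner k := by rcases hk with rfl | rfl <;> assumption
      have h4 : v.partner k = incl i := by rw [← h3, ← hw, w.partner_partner]
      rw [← h4, v.partner_partner, h4, hw]
    rcases proj_cases x i with h3 | ⟨k, hk, h3, -⟩
    · rcases proj_cases y i with h4 | ⟨k, hk, h4, -⟩
      · rw [h3, h4, h]
      · exact (aux y x h1.symm h2.symm k hk h4).symm
    · exact aux x y h1 h2 k hk h3
  · exact h1
  · exact h2

theorem exists_insert {n : ℕ} (x : Pairing n) (c : Option (Letters n)) :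
    ∃ y : Pairing (n + 1), proj y = x ∧ code y = c := by
  classical
  have hft : flip (n + 1) (top n) ≠ top n := flip_ne _
  have nt : (top n).1 ∉ letters n := (not_mem_iff _).2 (Or.inl rfl)
  have nb : (flip (n + 1) (top n)).1 ∉ letters n := (not_mem_iff _).2 (Or.inr rfl)
  rcases c with _ | a
  · let f : Letters (n + 1) → Letters (n + 1) := fun k =>
      if h : k.1 ∈ letters n then incl (x.partner ⟨k.1, h⟩) else flip (n + 1) k
    have f_incl : ∀ i, f (incl i) = incl (x.partner i) := fun i => dif_pos i.2
    have f_top : f (top n) = flip (n + 1) (top n) := dif_neg nt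
    have f_bot : f (flip (n + 1) (top n)) = top n := (dif_neg nb).trans (flip_flip _)
    let y : Pairing (n + 1) :=
      { partner := f
        partner_partner := fun k => by
          rcases letters_cases k with ⟨i, rfl⟩ | rfl | rfl
          · rw [f_incl, f_incl, x.partner_partner]
          · rw [f_top, f_bot]
          · rw [f_bot, f_top]
        partner_ne := fun k => by
          rcases letters_cases k with ⟨i, rfl⟩ | rfl | rfl
          · rw [f_incl]; exact fun h => x.partner_ne i (incl_injective h)
          · rw [f_top]; exact hft
          · rw [f_bot]; exact hft.symm }
    refine ⟨y, Pairing.ext (funext fun i => proj_in (f_incl i)), code_eq_none.2 f_top⟩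
  · let f : Letters (n + 1) → Letters (n + 1) := fun k =>
      if h : k.1 ∈ letters n then
        if k = incl a then top n
        else if k = incl (x.partner a) then flip (n + 1) (top n)
        else incl (x.partner ⟨k.1, h⟩)
      else if k = top n then incl a else incl (x.partner a)
    have hpa : incl (x.partner a) ≠ incl a := fun h => x.partner_ne a (incl_injective h)
    have f_a : f (incl a) = top n := by
      exact (dif_pos (show (incl a).1 ∈ letters n from a.2)).trans (if_pos rfl)
    have f_pa : f (incl (x.partner a)) = flip (n + 1) (top n) := by
      exact (dif_pos (show (incl (x.partner a)).1 ∈ letters n from (x.partner a).2)).trans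
        ((if_neg hpa).trans (if_pos rfl))
    have f_incl : ∀ i, i ≠ a → i ≠ x.partner a → f (incl i) = incl (x.partner i) := by
      intro i h1 h2
      exact (dif_pos (show (incl i).1 ∈ letters n from i.2)).trans
        ((if_neg (fun h => h1 (incl_injective h))).trans
          (if_neg (fun h => h2 (incl_injective h))))
    have f_top : f (top n) = incl a := by
      exact (dif_neg nt).trans (if_pos rfl)
    have f_bot : f (flip (n + 1) (top n)) = incl (x.partner a) := by
      exact (dif_neg nb).trans (if_neg hft)
    let y : Pairing (n + 1) :=
      { partner := f
        partner_partner := fun k => by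
          rcases letters_cases k with ⟨i, rfl⟩ | rfl | rfl
          · by_cases h1 : i = a
            · subst h1; rw [f_a, f_top]
            by_cases h2 : i = x.partner a
            · subst h2; rw [f_pa, f_bot]
            rw [f_incl i h1 h2, f_incl, x.partner_partner]
            · exact fun h => h2 (by rw [← h, x.partner_partner])
            · intro h
              apply h1
              rw [← x.partner_partner i, h, x.partner_partner]
          · rw [f_top, f_a]
          · rw [f_bot, f_pa]
        partner_ne := fun k => by
          rcases letters_cases k with ⟨i, rfl⟩ | rfl | rfl
          · by_cases h1 : i = a
            · subst h1; rw [f_a]; exact (incl_ne_top _).symm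
            by_cases h2 : i = x.partner a
            · subst h2; rw [f_pa]; exact (incl_ne_bot _).symm
            rw [f_incl i h1 h2]
            exact fun h => x.partner_ne i (incl_injective h)
          · rw [f_top]; exact incl_ne_top _
          · rw [f_bot]; exact incl_ne_bot _ }
    refine ⟨y, Pairing.ext (funext fun i => ?_), code_eq_some.2 f_top⟩
    by_cases h1 : i = a
    · subst h1
      exact proj_out (x := y) (Or.inl rfl) f_a f_bot
    by_cases h2 : i = x.partner a
    · subst h2
      rw [x.partner_partner]
      exact proj_out (x := y) (Or.inr rfl) f_pa (by rw [flip_flip]; exact f_top)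
    exact proj_in (x := y) (f_incl i h1 h2)

theorem proj_smul {n : ℕ} {g : Perm (Letters (n + 1))} {h : Perm (Letters n)}
    (hi : ∀ i, g (incl i) = incl (h i)) (ht : g (top n) = top n)
    (hb : g (flip (n + 1) (top n)) = flip (n + 1) (top n)) (x : Pairing (n + 1)) :
    proj (g • x) = h • proj x := by
  apply Pairing.ext
  funext i
  obtain ⟨j, rfl⟩ := h.surjective i
  rw [smul_partner']
  rcases proj_cases x j with h1 | ⟨k, hk, h1, h2⟩
  · apply proj_in
    rw [← hi, smul_partner', h1, hi]
  · have hk1 : g k = k := by rcases hk with rfl | rfl <;> assumption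
    have hk2 : g (flip (n + 1) k) = flip (n + 1) k := by
      rcases flip_out hk with h | h <;> rw [h] <;> assumption
    refine proj_out hk ?_ ?_
    · rw [← hi, smul_partner', h1, hk1]
    · conv_lhs => rw [← hk2]
      rw [smul_partner', h2, hi]

theorem smul_partner_top_iff {n : ℕ} {g : Perm (Letters (n + 1))} (ht : g (top n) = top n)
    (hb : g (flip (n + 1) (top n)) = flip (n + 1) (top n)) (x : Pairing (n + 1)) :
    (g • x).partner (top n) = flip (n + 1) (top n) ↔
      x.partner (top n) = flip (n + 1) (top n) := by
  conv_lhs => lhs; rw [← ht]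
  conv_lhs => rhs; rw [← hb]
  rw [smul_partner']
  exact g.injective.eq_iff


/-! ### The projective limit `X` and the group `S(2∞)` -/

/-- The projective limit `X = lim X(n)`. -/
def XLim : Type := {x : ∀ n, Pairing n // ∀ n, proj (x (n + 1)) = x n}

/-- The projection `p_n : X → X(n)`. -/
def XLim.p (n : ℕ) (x : XLim) : Pairing n := x.1 n

theorem XLim.proj_p (x : XLim) (n : ℕ) : proj (x.p (n + 1)) = x.p n := x.2 n

/-- The Borel structure of `X`, generated by the projections `p_n`. -/
instance : MeasurableSpace XLim := MeasurableSpace.comap Subtype.val inferInstance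

theorem XLim.measurable_p (n : ℕ) : Measurable (XLim.p n) :=
  (measurable_pi_apply n).comp (comap_measurable Subtype.val)

theorem XLim.measurable_of_p {α : Type*} [MeasurableSpace α] {f : α → XLim}
    (h : ∀ n, Measurable fun a => (f a).p n) : Measurable f :=
  measurable_comap_iff.2 (measurable_pi_iff.2 h)

theorem XLim.ext_tail {x y : XLim} (N : ℕ) (h : ∀ n, N ≤ n → x.p n = y.p n) : x = y := by
  induction N with
  | zero => exact Subtype.ext (funext fun n => h n n.zero_le)
  | succ N ih =>
    apply ih
    intro n hn
    rcases Nat.lt_or_ge N n with h1 | h1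
    · exact h n h1
    · obtain rfl : n = N := le_antisymm h1 hn
      rw [← x.proj_p, ← y.proj_p, h _ le_rfl]

theorem XLim.exists_of_tail (N : ℕ) (y : ∀ n, Pairing n)
    (h : ∀ n, N ≤ n → proj (y (n + 1)) = y n) : ∃ x : XLim, ∀ n, N ≤ n → x.p n = y n := by
  induction N generalizing y with
  | zero => exact ⟨⟨y, fun n => h n n.zero_le⟩, fun _ _ => rfl⟩
  | succ N ih =>
    obtain ⟨x, hx⟩ := ih (fun n => proj (y (n + 1))) (fun n hn => by rw [h (n + 1) (by omega)])
    exact ⟨x, fun n hn => by rw [hx n (by omega), h n hn]⟩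

theorem XLim.eq_of_p_eq {x y : XLim} {m n : ℕ} (h : m ≤ n) (hp : x.p n = y.p n) :
    x.p m = y.p m := by
  induction n, h using Nat.le_induction with
  | base => exact hp
  | succ n hn ih => exact ih (by rw [← x.proj_p, ← y.proj_p, hp])

/-- `g` belongs to the subgroup `S(2n)` of permutations moving only `-n, …, -1, 1, …, n`. -/
def Supported (n : ℕ) (g : Perm ℤ) : Prop := ∀ k, k ∉ letters n → g k = k

theorem Supported.mono {m n : ℕ} (h : m ≤ n) {g : Perm ℤ} (hg : Supported m g) :
    Supported n g := fun k hk => hg k fun hk' => hk (letters_mono h hk')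

theorem Supported.mul {n : ℕ} {g h : Perm ℤ} (hg : Supported n g) (hh : Supported n h) :
    Supported n (g * h) := fun k hk => by rw [Perm.mul_apply, hh k hk, hg k hk]

theorem Supported.inv {n : ℕ} {g : Perm ℤ} (hg : Supported n g) : Supported n g⁻¹ :=
  fun k hk => by rw [Perm.inv_eq_iff_eq, hg k hk]

theorem Supported.mem_iff {n : ℕ} {g : Perm ℤ} (hg : Supported n g) (k : ℤ) :
    g k ∈ letters n ↔ k ∈ letters n := by
  constructor
  · intro h
    by_contra h'
    rw [hg k h'] at h
    exact h' h
  · intro h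
    by_contra h'
    rw [g.injective (hg _ h')] at h'
    exact h' h

/-- The group `S(2∞)`, the union of the groups `S(2n)`. -/
def S2inf : Subgroup (Perm ℤ) where
  carrier := {g | ∃ n, Supported n g}
  one_mem' := ⟨0, fun _ _ => rfl⟩
  mul_mem' := by
    rintro g h ⟨m, hm⟩ ⟨n, hn⟩
    exact ⟨max m n, (hm.mono (le_max_left _ _)).mul (hn.mono (le_max_right _ _))⟩
  inv_mem' := by
    rintro g ⟨m, hm⟩
    exact ⟨m, hm.inv⟩

theorem supported_ofSubtype {n : ℕ} (g : Perm (Letters n)) : Supported n (Perm.ofSubtype g) :=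
  fun _ hk => Perm.ofSubtype_apply_of_not_mem g hk

/-- The inclusion `S(2n) → S(2∞)`. -/
def toS2inf (n : ℕ) : Perm (Letters n) →* S2inf :=
  (Perm.ofSubtype : Perm (Letters n) →* Perm ℤ).codRestrict S2inf
    fun g => ⟨n, supported_ofSubtype g⟩

/-- An element of `S(2n) ⊆ S(2∞)` as a permutation of `{-n, …, -1, 1, …, n}` (the identity if `g`
does not lie in `S(2n)`). -/
def restr (n : ℕ) (g : Perm ℤ) : Perm (Letters n) := by
  classical
  exact if h : Supported n g then g.subtypePerm h.mem_iff else 1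

theorem restr_apply {n : ℕ} {g : Perm ℤ} (h : Supported n g) (i : Letters n) :
    (restr n g i).1 = g i.1 := by
  unfold restr
  rw [dif_pos h]; rfl

theorem restr_mul {n : ℕ} {g h : Perm ℤ} (hg : Supported n g) (hh : Supported n h) :
    restr n (g * h) = restr n g * restr n h := by
  ext i
  rw [restr_apply (hg.mul hh), Perm.mul_apply, Perm.mul_apply, restr_apply hg, restr_apply hh]

theorem restr_one (n : ℕ) : restr n 1 = 1 := by
  ext i
  rw [restr_apply (fun _ _ => rfl)]; rfl

theorem restr_toS2inf {n : ℕ} (g : Perm (Letters n)) : restr n (toS2inf n g : Perm ℤ) = g := by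
  ext i
  exact (restr_apply (supported_ofSubtype g) i).trans (Perm.ofSubtype_apply_coe g i)

theorem restr_incl {n : ℕ} {g : Perm ℤ} (hg : Supported n g) (i : Letters n) : restr (n + 1) g (incl i) = incl (restr n g i) :=
  Subtype.ext (by
    rw [restr_apply (hg.mono n.le_succ)]
    exact (restr_apply hg i).symm)

theorem restr_out {n : ℕ} {g : Perm ℤ} (hg : Supported n g) {k : Letters (n + 1)}
    (hk : k = top n ∨ k = flip (n + 1) (top n)) :
    restr (n + 1) g k = k :=
  Subtype.ext (by
    rw [restr_apply (hg.mono n.le_succ)]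
    exact hg _ ((not_mem_iff k).2 hk))

/-- The projections are equivariant. -/
theorem proj_restr_smul {n : ℕ} {g : Perm ℤ} (hg : Supported n g) (x : Pairing (n + 1)) :
    proj (restr (n + 1) g • x) = restr n g • proj x :=
  proj_smul (restr_incl hg) (restr_out hg (Or.inl rfl)) (restr_out hg (Or.inr rfl)) x

theorem circles_diff_succ {n : ℕ} {g : Perm ℤ} (hg : Supported n g) (x : Pairing (n + 1)) :
    ((restr (n + 1) g • x).circles : ℤ) - x.circles =
      ((restr n g • proj x).circles : ℤ) - (proj x).circles := by
  rw [circles_proj (restr (n + 1) g • x), circles_proj x, proj_restr_smul hg]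
  simp only [smul_partner_top_iff (restr_out hg (Or.inl rfl)) (restr_out hg (Or.inr rfl))]
  push_cast
  ring

/-- The least `n` with `g ∈ S(2n)`. -/
def level (g : S2inf) : ℕ := by
  classical
  exact Nat.find g.2

theorem supported_level (g : S2inf) : Supported (level g) (g : Perm ℤ) := by
  classical
  exact Nat.find_spec g.2

theorem level_le {g : S2inf} {n : ℕ} (h : Supported n (g : Perm ℤ)) : level g ≤ n := by
  classical
  exact Nat.find_min' g.2 h

theorem XLim.exists_smul (g : S2inf) (x : XLim) :
    ∃ y : XLim, ∀ n, level g ≤ n → y.p n = restr n (g : Perm ℤ) • x.p n :=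
  XLim.exists_of_tail (level g) (fun n => restr n (g : Perm ℤ) • x.p n) fun n hn => by
    rw [proj_restr_smul ((supported_level g).mono hn), x.proj_p]

instance : SMul S2inf XLim := ⟨fun g x => (XLim.exists_smul g x).choose⟩

theorem XLim.p_smul {g : S2inf} {n : ℕ} (h : Supported n (g : Perm ℤ)) (x : XLim) :
    (g • x).p n = restr n (g : Perm ℤ) • x.p n :=
  (XLim.exists_smul g x).choose_spec n (level_le h)

/-- The action of `S(2∞)` on `X`: `(x · g)_n = x_n · g` for all `n` with `g ∈ S(2n)`.  As for
`X(n)`, the right action `x · g` of the literature is written `g • x`. -/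
instance : MulAction S2inf XLim where
  one_smul x := by
    apply XLim.ext_tail 0
    intro n _
    rw [XLim.p_smul (fun _ _ => rfl)]
    exact (congrArg (· • x.p n) (restr_one n)).trans (one_smul _ _)
  mul_smul g h x := by
    apply XLim.ext_tail (max (level g) (level h))
    intro n hn
    have hg : Supported n (g : Perm ℤ) :=
      (supported_level g).mono ((le_max_left _ _).trans hn)
    have hh : Supported n (h : Perm ℤ) :=
      (supported_level h).mono ((le_max_right _ _).trans hn)
    rw [XLim.p_smul hg, XLim.p_smul hh, XLim.p_smul (hg.mul hh), smul_smul, ← restr_mul hg hh]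
    rfl

/-- The fundamental cocycle `c(x; g) = [x_n · g]_n - [x_n]_n`, where `n` is so large that
`g ∈ S(2n)` (see `cocycle_eq` for the independence of `n`). -/
def cocycle (x : XLim) (g : S2inf) : ℤ :=
  (((g • x).p (level g)).circles : ℤ) - (x.p (level g)).circles

theorem cocycle_eq {g : S2inf} {n : ℕ} (h : Supported n (g : Perm ℤ)) (x : XLim) :
    cocycle x g = (((g • x).p n).circles : ℤ) - (x.p n).circles := by
  have h' := level_le h
  clear h
  induction n, h' using Nat.le_induction with
  | base => rfl
  | succ n hn ih =>
    have hs := (supported_level g).mono hn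
    rw [ih, XLim.p_smul hs, XLim.p_smul (hs.mono n.le_succ), circles_diff_succ hs, x.proj_p]

theorem cocycle_one (x : XLim) : cocycle x 1 = 0 := by
  rw [cocycle, one_smul, sub_self]

theorem cocycle_mul (x : XLim) (g h : S2inf) :
    cocycle x (g * h) = cocycle (h • x) g + cocycle x h := by
  have hg := (supported_level g).mono (le_max_left (level g) (level h))
  have hh := (supported_level h).mono (le_max_right (level g) (level h))
  rw [cocycle_eq (hg.mul hh : Supported _ ((g * h : S2inf) : Perm ℤ)), cocycle_eq hg,
    cocycle_eq hh, mul_smul]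
  ring

theorem XLim.exists_supported (g : S2inf) (m : ℕ) : ∃ n, m ≤ n ∧ Supported n (g : Perm ℤ) :=
  ⟨max m (level g), le_max_left _ _, (supported_level g).mono (le_max_right _ _)⟩


/-! ### The measures `μ_t` -/

/-- The weight `μ_t^{(n)}(x) = t^{[x]ₙ} / (t (t + 2) ⋯ (t + 2n - 2))`. -/
def weight (t : ℝ) {n : ℕ} (x : Pairing n) : ℝ :=
  t ^ x.circles / ∏ k ∈ Finset.range n, (t + 2 * k)

theorem card_letters (n : ℕ) : Fintype.card (Letters n) = 2 * n := by
  rw [Fintype.card_coe, letters, Finset.card_erase_of_mem (by simp), Int.card_Icc]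
  omega

instance : Subsingleton (Pairing 0) :=
  ⟨fun x y => Pairing.ext (funext fun i => by
    have := Fintype.card_eq_zero_iff.1 (card_letters 0)
    exact this.elim i)⟩

theorem weight_zero (t : ℝ) (x : Pairing 0) : weight t x = 1 := by
  have := Fintype.card_eq_zero_iff.1 (card_letters 0)
  have h : x.circles = 0 := by
    unfold Pairing.circles
    have : IsEmpty (Quot x.step) := ⟨fun q => by
      induction q using Quot.ind with
      | mk i => exact this.elim i⟩
    exact Nat.card_of_isEmpty
  simp [weight, h]

theorem weight_succ {t : ℝ} (ht : 0 < t) {n : ℕ} (x : Pairing (n + 1)) :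
    weight t x = weight t (proj x) * (code x).elim (t / (t + 2 * n)) (fun _ => 1 / (t + 2 * n)) := by
  have h1 : t + 2 * (n : ℝ) ≠ 0 := by positivity
  have h2 : ∏ k ∈ Finset.range n, (t + 2 * (k : ℝ)) ≠ 0 :=
    Finset.prod_ne_zero_iff.2 fun k _ => by positivity
  unfold weight
  rw [circles_proj x, Finset.prod_range_succ]
  rcases h : code x with _ | a
  · rw [if_pos (code_eq_none.1 h), pow_succ]
    simp only [Option.elim_none]
    field_simp
  · rw [if_neg (fun h' => by rw [code_eq_none.2 h'] at h; simp at h)]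
    simp only [Option.elim_some, add_zero]
    field_simp

theorem exists_ewens {t : ℝ} (ht : 0 < t) : ∃ μ : Measure XLim, IsProbabilityMeasure μ ∧
    ∀ (n : ℕ) (x : Pairing n), μ (XLim.p n ⁻¹' {x}) = ENNReal.ofReal (weight t x) := by
  classical
  let _ : ∀ k, MeasurableSpace (Option (Letters k)) := fun _ => ⊤
  have _ : ∀ k, DiscreteMeasurableSpace (Option (Letters k)) := fun _ => ⟨fun _ => trivial⟩
  let f : ∀ k : ℕ, Option (Letters k) → ℝ :=
    fun k o => o.elim (t / (t + 2 * k)) (fun _ => 1 / (t + 2 * k))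
  have f_nonneg : ∀ k o, 0 ≤ f k o := by
    intro k o
    rcases o with _ | a <;> simp only [f, Option.elim_none, Option.elim_some] <;> positivity
  have f_sum : ∀ k, ∑ o, f k o = 1 := by
    intro k
    have h1 : t + 2 * (k : ℝ) ≠ 0 := by positivity
    simp only [f, Fintype.sum_option, Option.elim_none, Option.elim_some, Finset.sum_const,
      Finset.card_univ, card_letters, nsmul_eq_mul]
    push_cast
    field_simp
  let q : ∀ k, PMF (Option (Letters k)) := fun k =>
    PMF.ofFintype (fun o => ENNReal.ofReal (f k o)) (by
      rw [← ENNReal.ofReal_sum_of_nonneg (fun o _ => f_nonneg k o), f_sum, ENNReal.ofReal_one])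
  let ν : Measure (∀ k, Option (Letters k)) := Measure.infinitePi fun k => (q k).toMeasure
  choose ins ins_proj ins_code using fun n => @exists_insert n
  let dec : (∀ k, Option (Letters k)) → ∀ n, Pairing n := fun ω n =>
    Nat.rec (basePairing 0) (fun n x => ins n x (ω n)) n
  have dec_succ : ∀ ω n, dec ω (n + 1) = ins n (dec ω n) (ω n) := fun _ _ => rfl
  have key : ∀ n (x : Pairing n), ∃ a : ∀ k, Option (Letters k),
      (∀ ω, dec ω n = x ↔ ∀ k ∈ Finset.range n, ω k = a k) ∧
      ∏ k ∈ Finset.range n, f k (a k) = weight t x := by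
    intro n
    induction n with
    | zero =>
      intro x
      refine ⟨fun _ => none, fun ω => ⟨fun _ => by simp, fun _ => Subsingleton.elim _ _⟩, ?_⟩
      rw [weight_zero]; simp
    | succ n ih =>
      intro x
      obtain ⟨a, ha, hw⟩ := ih (proj x)
      have hne : ∀ k ∈ Finset.range n, Function.update a n (code x) k = a k := fun k hk =>
        Function.update_of_ne (Finset.mem_range.1 hk).ne _ _
      refine ⟨Function.update a n (code x), fun ω => ?_, ?_⟩
      · rw [Finset.range_add_one, Finset.forall_mem_insert, Function.update_self, dec_succ]
        have h2 : (∀ k ∈ Finset.range n, ω k = Function.update a n (code x) k) ↔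
            dec ω n = proj x := by
          rw [ha]
          exact forall₂_congr fun k hk => by rw [hne k hk]
        rw [h2]
        constructor
        · rintro h
          rw [← h, ins_proj, ins_code]
          exact ⟨rfl, rfl⟩
        · rintro ⟨h3, h4⟩
          apply ext_of_proj_code
          · rw [ins_proj, h4]
          · rw [ins_code, h3]
      · rw [Finset.prod_range_succ, Function.update_self, weight_succ ht, ← hw]
        congr 1
        exact Finset.prod_congr rfl fun k hk => by rw [hne k hk]
  have hset : ∀ n (x : Pairing n), MeasurableSet {ω | dec ω n = x} ∧
      ν {ω | dec ω n = x} = ENNReal.ofReal (weight t x) := by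
    intro n x
    obtain ⟨a, ha, hw⟩ := key n x
    have : {ω | dec ω n = x} = Set.pi (Finset.range n) (fun k => {a k}) := by
      ext ω
      simp only [Set.mem_ofPred_eq, ha, Set.mem_pi, Set.mem_singleton_iff, Finset.mem_coe]
    rw [this]
    refine ⟨MeasurableSet.pi (Finset.range n).countable_toSet fun _ _ => MeasurableSet.of_discrete, ?_⟩
    rw [Measure.infinitePi_pi _ (fun _ _ => MeasurableSet.of_discrete), ← hw,
      ENNReal.ofReal_prod_of_nonneg (fun k _ => f_nonneg k _)]
    refine Finset.prod_congr rfl fun k _ => ?_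
    rw [PMF.toMeasure_apply_singleton _ _ MeasurableSet.of_discrete]
    rfl
  let D : (∀ k, Option (Letters k)) → XLim := fun ω => ⟨dec ω, fun n => by
    rw [dec_succ, ins_proj]⟩
  have hD : Measurable D :=
    XLim.measurable_of_p fun n => measurable_to_countable' fun x => (hset n x).1
  refine ⟨ν.map D, Measure.isProbabilityMeasure_map hD.aemeasurable, fun n x => ?_⟩
  rw [Measure.map_apply hD (XLim.measurable_p n (measurableSet_singleton x)), ← (hset n x).2]
  rfl

/-- The probability measure `μ_t = lim μ_t^{(n)}` on `X`: its image on `X(n)` is `μ_t^{(n)}`. -/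
def ewens {t : ℝ} (ht : 0 < t) : Measure XLim := (exists_ewens ht).choose

instance {t : ℝ} (ht : 0 < t) : IsProbabilityMeasure (ewens ht) :=
  (exists_ewens ht).choose_spec.1

theorem ewens_cylinder {t : ℝ} (ht : 0 < t) {n : ℕ} (x : Pairing n) :
    ewens ht (XLim.p n ⁻¹' {x}) = ENNReal.ofReal (weight t x) :=
  (exists_ewens ht).choose_spec.2 n x


theorem XLim.exists_factor {m n : ℕ} (h : m ≤ n) :
    ∃ f : Pairing n → Pairing m, ∀ x : XLim, x.p m = f (x.p n) := by
  induction n, h using Nat.le_induction with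
  | base => exact ⟨id, fun _ => rfl⟩
  | succ n hn ih =>
    obtain ⟨f, hf⟩ := ih
    exact ⟨fun y => f (proj y), fun x => by
      rw [hf, ← x.proj_p]⟩

theorem XLim.measure_ext {μ ν : Measure XLim} [IsFiniteMeasure μ] (N : ℕ)
    (h : ∀ n, N ≤ n → ∀ x : Pairing n, μ (XLim.p n ⁻¹' {x}) = ν (XLim.p n ⁻¹' {x})) : μ = ν := by
  let C : Set (Set XLim) := {s | ∃ n, N ≤ n ∧ ∃ x : Pairing n, s = XLim.p n ⁻¹' {x}}
  have hgen : (inferInstance : MeasurableSpace XLim) = MeasurableSpace.generateFrom C := by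
    apply le_antisymm
    · have hid : @Measurable XLim XLim (MeasurableSpace.generateFrom C) _ id := by
        refine @XLim.measurable_of_p XLim (MeasurableSpace.generateFrom C) id fun n => ?_
        obtain ⟨f, hf⟩ := XLim.exists_factor (le_max_left n N)
        have h1 : @Measurable XLim (Pairing (max n N)) (MeasurableSpace.generateFrom C) _
            (XLim.p (max n N)) := by
          refine @measurable_to_countable' _ _ _ _ (MeasurableSpace.generateFrom C) _ fun x => ?_
          exact MeasurableSpace.measurableSet_generateFrom ⟨_, le_max_right _ _, x, rfl⟩
        have h2 : (fun a : XLim => (id a).p n) = f ∘ XLim.p (max n N) := funext hf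
        rw [h2]
        exact (measurable_of_countable f).comp h1
      intro s hs
      exact hid hs
    · apply MeasurableSpace.generateFrom_le
      rintro s ⟨n, -, x, rfl⟩
      exact XLim.measurable_p n (measurableSet_singleton x)
  have hpi : IsPiSystem C := by
    have key : ∀ m n, m ≤ n → N ≤ n → ∀ (x : Pairing m) (y : Pairing n),
        (XLim.p m ⁻¹' {x} ∩ XLim.p n ⁻¹' {y}).Nonempty →
        XLim.p m ⁻¹' {x} ∩ XLim.p n ⁻¹' {y} ∈ C := by
      rintro m n hmn hn x y ⟨w, hw1, hw2⟩
      refine ⟨n, hn, y, Set.inter_eq_right.2 ?_⟩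
      intro v hv
      have h1 : v.p n = w.p n := Eq.trans hv (Eq.symm hw2)
      exact (XLim.eq_of_p_eq hmn h1).trans hw1
    rintro _ ⟨m, hm, x, rfl⟩ _ ⟨n, hn, y, rfl⟩ hne
    rcases le_total m n with hmn | hmn
    · exact key m n hmn hn x y hne
    · rw [Set.inter_comm] at hne ⊢
      exact key n m hmn hm y x hne
  refine Measure.ext_of_generateFrom_of_cover_subset hgen hpi
    (T := Set.range fun x : Pairing N => XLim.p N ⁻¹' {x}) ?_ (Set.countable_range _) ?_
    (fun _ _ => measure_ne_top _ _) ?_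
  · rintro _ ⟨x, rfl⟩
    exact ⟨N, le_rfl, x, rfl⟩
  · ext w
    simp
  · rintro _ ⟨n, hn, x, rfl⟩
    exact h n hn x

theorem measurable_smul_XLim (g : S2inf) : Measurable fun x : XLim => g • x := by
  refine XLim.measurable_of_p fun m => ?_
  obtain ⟨n, hmn, hn⟩ := XLim.exists_supported g m
  obtain ⟨f, hf⟩ := XLim.exists_factor hmn
  have : (fun x : XLim => (g • x).p m) =
      (fun y => f (restr n (g : Perm ℤ) • y)) ∘ XLim.p n := by
    funext x
    rw [hf, XLim.p_smul hn]; rfl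
  rw [this]
  exact (measurable_of_countable _).comp (XLim.measurable_p n)

theorem measurable_cocycle (g : S2inf) : Measurable fun x : XLim => cocycle x g := by
  have : (fun x : XLim => cocycle x g) =
      (fun y => ((restr (level g) (g : Perm ℤ) • y).circles : ℤ) - y.circles) ∘
        XLim.p (level g) := by
    funext x
    rw [cocycle, XLim.p_smul (supported_level g)]; rfl
  rw [this]
  exact (measurable_of_countable _).comp (XLim.measurable_p _)

/-- Quasi-invariance of `μ_t`, with density `t ^ c(x; g)`. -/
theorem ewens_quasi {t : ℝ} (ht : 0 < t) (g : S2inf) :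
    ((ewens ht).withDensity fun x => ENNReal.ofReal (t ^ cocycle x g)).map (g • ·) =
      ewens ht := by
  symm
  apply XLim.measure_ext (level g)
  intro n hn y
  have hg : Supported n (g : Perm ℤ) := (supported_level g).mono hn
  set r := restr n (g : Perm ℤ) with hr
  have hpre : (fun x : XLim => g • x) ⁻¹' (XLim.p n ⁻¹' {y}) = XLim.p n ⁻¹' {r⁻¹ • y} := by
    ext x
    simp only [Set.mem_preimage, Set.mem_singleton_iff]
    rw [XLim.p_smul hg, eq_inv_smul_iff]
  have hm : MeasurableSet (XLim.p n ⁻¹' {r⁻¹ • y}) :=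
    XLim.measurable_p n (measurableSet_singleton _)
  rw [Measure.map_apply (measurable_smul_XLim g) (XLim.measurable_p n (measurableSet_singleton y)),
    hpre, withDensity_apply _ hm]
  have hconst : ∀ x ∈ XLim.p n ⁻¹' {r⁻¹ • y}, ENNReal.ofReal (t ^ cocycle x g) =
      ENNReal.ofReal (t ^ ((y.circles : ℤ) - (r⁻¹ • y).circles)) := by
    intro x hx
    have hx' : x.p n = r⁻¹ • y := hx
    rw [cocycle_eq hg, XLim.p_smul hg, hx', smul_inv_smul]
  rw [setLIntegral_congr_fun hm hconst, setLIntegral_const, ewens_cylinder, ewens_cylinder,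
    ← ENNReal.ofReal_mul (by positivity)]
  congr 1
  unfold weight
  rw [zpow_sub₀ ht.ne', zpow_natCast, zpow_natCast]
  field_simp

theorem quasiMeasurePreserving_smul {t : ℝ} (ht : 0 < t) (g : S2inf) :
    Measure.QuasiMeasurePreserving (fun x : XLim => g • x) (ewens ht) (ewens ht) := by
  refine ⟨measurable_smul_XLim g, ?_⟩
  have hd : Measurable fun x : XLim => ENNReal.ofReal (t ^ cocycle x g) :=
    ENNReal.measurable_ofReal.comp
      ((measurable_of_countable fun k : ℤ => t ^ k).comp (measurable_cocycle g))
  have h1 : ewens ht ≪ (ewens ht).withDensity fun x => ENNReal.ofReal (t ^ cocycle x g) :=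
    withDensity_absolutelyContinuous' hd.aemeasurable
      (Filter.Eventually.of_forall fun x => by
        simp only [ne_eq, ENNReal.ofReal_eq_zero, not_le]
        positivity)
  have h2 := h1.map (measurable_smul_XLim g)
  rwa [ewens_quasi] at h2

/-! ### The representation `T_{z,1/2}` -/

theorem sq_norm_pos {z : ℂ} (hz : z ≠ 0) : 0 < ‖z‖ ^ 2 := by positivity

/-- The Hilbert space `L²(X, μ_t)` with `t = |z|²`. -/
abbrev L2 {z : ℂ} (hz : z ≠ 0) : Type := Lp ℂ 2 (ewens (sq_norm_pos hz))

/-- The function `x ↦ z ^ c(x; g) f(x · g)`. -/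
def twist (z : ℂ) (g : S2inf) (f : XLim → ℂ) (x : XLim) : ℂ := z ^ cocycle x g * f (g • x)

theorem twist_congr {z : ℂ} (hz : z ≠ 0) (g : S2inf) {f f' : XLim → ℂ}
    (h : f =ᵐ[ewens (sq_norm_pos hz)] f') :
    twist z g f =ᵐ[ewens (sq_norm_pos hz)] twist z g f' := by
  filter_upwards [(quasiMeasurePreserving_smul (sq_norm_pos hz) g).ae_eq_comp h] with x hx
  unfold twist
  exact congrArg _ hx

theorem eLpNorm_twist {z : ℂ} (hz : z ≠ 0) (g : S2inf) {f : XLim → ℂ}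
    (hf : AEStronglyMeasurable f (ewens (sq_norm_pos hz))) :
    eLpNorm (twist z g f) 2 (ewens (sq_norm_pos hz)) =
      eLpNorm f 2 (ewens (sq_norm_pos hz)) := by
  have hmain : ∀ f : XLim → ℂ, StronglyMeasurable f →
      eLpNorm (twist z g f) 2 (ewens (sq_norm_pos hz)) =
        eLpNorm f 2 (ewens (sq_norm_pos hz)) := by
    intro f hf
    have hd : Measurable fun x : XLim => ENNReal.ofReal ((‖z‖ ^ 2) ^ cocycle x g) :=
      ENNReal.measurable_ofReal.comp
        ((measurable_of_countable fun k : ℤ => (‖z‖ ^ 2) ^ k).comp (measurable_cocycle g))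
    have hF : Measurable fun x => ‖f x‖ₑ ^ (2 : ℝ) := hf.measurable.enorm.pow_const _
    rw [eLpNorm_eq_lintegral_rpow_enorm_toReal (by norm_num) (by norm_num),
      eLpNorm_eq_lintegral_rpow_enorm_toReal (by norm_num) (by norm_num)]
    congr 1
    simp only [ENNReal.toReal_ofNat]
    conv_rhs => rw [← ewens_quasi (sq_norm_pos hz) g]
    rw [lintegral_map hF (measurable_smul_XLim g),
      lintegral_withDensity_eq_lintegral_mul _ hd
        (show Measurable fun x : XLim => ‖f (g • x)‖ₑ ^ (2 : ℝ) from
          hF.comp (measurable_smul_XLim g))]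
    refine lintegral_congr fun x => ?_
    simp only [twist, Pi.mul_apply]
    rw [enorm_mul, ENNReal.mul_rpow_of_nonneg _ _ (by norm_num)]
    congr 1
    rw [← ofReal_norm, norm_zpow, ENNReal.rpow_two, ← ENNReal.ofReal_pow (by positivity)]
    congr 1
    rw [← zpow_natCast, ← zpow_natCast, ← zpow_mul, ← zpow_mul, mul_comm]
  rw [eLpNorm_congr_ae (twist_congr hz g hf.ae_eq_mk), hmain _ hf.stronglyMeasurable_mk,
    eLpNorm_congr_ae hf.ae_eq_mk]

theorem memLp_twist {z : ℂ} (hz : z ≠ 0) (g : S2inf) {f : XLim → ℂ}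
    (hf : MemLp f 2 (ewens (sq_norm_pos hz))) :
    MemLp (twist z g f) 2 (ewens (sq_norm_pos hz)) := by
  refine ⟨?_, by rw [eLpNorm_twist hz g hf.1]; exact hf.2⟩
  refine AEStronglyMeasurable.mul ?_ ?_
  · exact ((measurable_of_countable fun k : ℤ => z ^ k).comp
      (measurable_cocycle g)).aestronglyMeasurable
  · exact hf.1.comp_quasiMeasurePreserving (quasiMeasurePreserving_smul _ g)

theorem twist_one (z : ℂ) (f : XLim → ℂ) : twist z 1 f = f := by
  funext x
  simp [twist, cocycle_one]

theorem twist_twist {z : ℂ} (hz : z ≠ 0) (g h : S2inf) (f : XLim → ℂ) :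
    twist z g (twist z h f) = twist z (h * g) f := by
  funext x
  simp only [twist]
  rw [cocycle_mul, mul_smul, zpow_add₀ hz]
  ring

/-- The operator `(T(g) f)(x) = z ^ c(x; g) f(x · g)` as an isometry of `L²(X, μ_t)`. -/
def opT {z : ℂ} (hz : z ≠ 0) (g : S2inf) : L2 hz →ₗᵢ[ℂ] L2 hz where
  toFun f := (memLp_twist hz g (Lp.memLp f)).toLp _
  map_add' f₁ f₂ := by
    rw [← MemLp.toLp_add]
    apply MemLp.toLp_congr
    refine (twist_congr hz g (Lp.coeFn_add f₁ f₂)).trans (Filter.Eventually.of_forall fun x => ?_)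
    simp only [twist, Pi.add_apply, mul_add]
  map_smul' c f := by
    rw [RingHom.id_apply, ← MemLp.toLp_const_smul]
    apply MemLp.toLp_congr
    refine (twist_congr hz g (Lp.coeFn_smul c f)).trans (Filter.Eventually.of_forall fun x => ?_)
    simp only [twist, Pi.smul_apply, smul_eq_mul]
    ring
  norm_map' f := by
    change ‖(memLp_twist hz g (Lp.memLp f)).toLp _‖ = ‖f‖
    rw [Lp.norm_toLp, eLpNorm_twist hz g (Lp.aestronglyMeasurable f), Lp.norm_def]

theorem coeFn_opT {z : ℂ} (hz : z ≠ 0) (g : S2inf) (f : L2 hz) :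
    opT hz g f =ᵐ[ewens (sq_norm_pos hz)] twist z g f :=
  MemLp.coeFn_toLp (memLp_twist hz g (Lp.memLp f))

theorem opT_opT {z : ℂ} (hz : z ≠ 0) (g h : S2inf) (f : L2 hz) :
    opT hz g (opT hz h f) = opT hz (h * g) f := by
  apply Lp.ext
  refine (coeFn_opT hz g _).trans ((twist_congr hz g (coeFn_opT hz h f)).trans ?_)
  rw [twist_twist hz]
  exact (coeFn_opT hz _ f).symm

theorem opT_one {z : ℂ} (hz : z ≠ 0) (f : L2 hz) : opT hz 1 f = f := by
  apply Lp.ext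
  refine (coeFn_opT hz 1 f).trans ?_
  rw [twist_one]

/-- The unitary representation `T_{z,1/2}` of `S(2∞)` in `L²(X, μ_t)`, `t = |z|²`, given by
`(T(g) f)(x) = z ^ c(x; g) f(x · g)`.  The group is `S2infᵐᵒᵖ`, since permutations acting from the
right are multiplied from left to right. -/
def repT {z : ℂ} (hz : z ≠ 0) : S2infᵐᵒᵖ →* (L2 hz ≃ₗᵢ[ℂ] L2 hz) where
  toFun g :=
    { (opT hz g.unop).toLinearMap with
      invFun := opT hz g.unop⁻¹
      left_inv := fun f => by
        change opT hz g.unop⁻¹ (opT hz g.unop f) = f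
        rw [opT_opT, mul_inv_cancel, opT_one]
      right_inv := fun f => by
        change opT hz g.unop (opT hz g.unop⁻¹ f) = f
        rw [opT_opT, inv_mul_cancel, opT_one]
      norm_map' := (opT hz g.unop).norm_map }
  map_one' := LinearIsometryEquiv.ext fun f => opT_one hz f
  map_mul' g h := LinearIsometryEquiv.ext fun f => (opT_opT hz g.unop h.unop f).symm

/-- The spherical vector of `T_{z,1/2}`: the function identically equal to `1`. -/
def oneVec {z : ℂ} (hz : z ≠ 0) : L2 hz :=
  (memLp_const (1 : ℂ) : MemLp (fun _ : XLim => (1 : ℂ)) 2 (ewens (sq_norm_pos hz))).toLp _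

/-- The vector `1` is a unit vector. -/
theorem norm_oneVec {z : ℂ} (hz : z ≠ 0) : ‖oneVec hz‖ = 1 := by
  rw [oneVec, Lp.norm_toLp, eLpNorm_const _ (by norm_num) (IsProbabilityMeasure.ne_zero _)]
  simp

theorem circles_smul {n : ℕ} {h : Perm (Letters n)} (hh : h ∈ hyperoctahedral n)
    (x : Pairing n) : (h • x).circles = x.circles := by
  have hc : ∀ i, h (flip n i) = flip n (h i) := fun i =>
    (congrArg (fun σ : Perm (Letters n) => σ i)
      (Subgroup.mem_centralizer_iff.1 hh (flip n) rfl)).symm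
  refine (Nat.card_congr (Quot.congr h fun i j => ?_)).symm
  unfold Pairing.step
  rw [smul_partner', ← hc, h.injective.eq_iff, h.injective.eq_iff]

/-- The vector `1` is invariant under `H(∞)`, the union of the groups `H(n)`. -/
theorem repT_oneVec {z : ℂ} (hz : z ≠ 0) {n : ℕ} {h : Perm (Letters n)}
    (hh : h ∈ hyperoctahedral n) :
    repT hz (MulOpposite.op (toS2inf n h)) (oneVec hz) = oneVec hz := by
  apply Lp.ext
  have h1 : oneVec hz =ᵐ[ewens (sq_norm_pos hz)] fun _ => 1 := MemLp.coeFn_toLp _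
  refine (coeFn_opT hz (toS2inf n h) (oneVec hz)).trans ((twist_congr hz _ h1).trans ?_)
  refine Filter.EventuallyEq.trans (Filter.Eventually.of_forall fun x => ?_) h1.symm
  have hs : Supported n (toS2inf n h : Perm ℤ) := supported_ofSubtype h
  rw [twist, cocycle_eq hs, XLim.p_smul hs, restr_toS2inf, circles_smul hh, sub_self, zpow_zero,
    mul_one]

/-- The spherical function `φ_z(g) = (T(g) 1, 1)` (the inner product `(ξ, η)` of the literature is
linear in `ξ`, and `inner ℂ η ξ` in Lean). -/
def sphericalFun {z : ℂ} (hz : z ≠ 0) (g : S2inf) : ℂ :=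
  inner ℂ (oneVec hz) (repT hz (MulOpposite.op g) (oneVec hz))


/-! ### Irreducible characters of symmetric groups -/

/-- The row symmetrizer: the sum of the permutations of the boxes of `μ` preserving each row. -/
def rowSymmetrizer (μ : YoungDiagram) : MonoidAlgebra ℂ (Perm μ.cells) := by
  classical
  exact ∑ σ : Perm μ.cells with ∀ c, (σ c).1.1 = c.1.1, MonoidAlgebra.of ℂ _ σ

/-- The column antisymmetrizer: the signed sum of the permutations preserving each column. -/
def colAntisymmetrizer (μ : YoungDiagram) : MonoidAlgebra ℂ (Perm μ.cells) := by
  classical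
  exact ∑ σ : Perm μ.cells with ∀ c, (σ c).1.2 = c.1.2,
    ((Perm.sign σ : ℤ) : ℂ) • MonoidAlgebra.of ℂ _ σ

/-- The Specht module `ℂ[S] · c_μ`, the left ideal generated by the Young symmetrizer `c_μ`, where
`S` is the group of permutations of the boxes of `μ`. -/
def spechtModule (μ : YoungDiagram) : Submodule ℂ (MonoidAlgebra ℂ (Perm μ.cells)) :=
  LinearMap.range (LinearMap.mulRight ℂ (rowSymmetrizer μ * colAntisymmetrizer μ))

theorem mul_mem_spechtModule {μ : YoungDiagram} (a : MonoidAlgebra ℂ (Perm μ.cells))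
    {v : MonoidAlgebra ℂ (Perm μ.cells)} (hv : v ∈ spechtModule μ) : a * v ∈ spechtModule μ := by
  obtain ⟨b, rfl⟩ := hv
  exact ⟨a * b, mul_assoc _ _ _⟩

/-- The irreducible representation attached to `μ`, by left multiplication on the Specht module. -/
def spechtRep (μ : YoungDiagram) : Representation ℂ (Perm μ.cells) (spechtModule μ) where
  toFun g := (LinearMap.mulLeft ℂ (MonoidAlgebra.of ℂ (Perm μ.cells) g)).restrict
    fun _ hv => mul_mem_spechtModule _ hv
  map_one' := LinearMap.ext fun v => Subtype.ext (by
    change MonoidAlgebra.of ℂ (Perm μ.cells) 1 * v.1 = v.1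
    rw [map_one, one_mul])
  map_mul' g h := LinearMap.ext fun v => Subtype.ext (by
    change MonoidAlgebra.of ℂ (Perm μ.cells) (g * h) * v.1 =
      MonoidAlgebra.of ℂ (Perm μ.cells) g * (MonoidAlgebra.of ℂ (Perm μ.cells) h * v.1)
    rw [map_mul, mul_assoc])

/-- The Young diagram `2μ = (2μ₁, 2μ₂, …)`, in which each box of `μ` is replaced by two boxes in the
same row. -/
def double (μ : YoungDiagram) : YoungDiagram where
  cells := (μ.cells ×ˢ Finset.range 2).image fun p => (p.1.1, 2 * p.1.2 + p.2)
  isLowerSet := by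
    rintro ⟨i, j⟩ ⟨i', j'⟩ h hm
    simp only [Finset.coe_image, Set.mem_image, Finset.mem_coe, Finset.mem_product,
      Finset.mem_range, Prod.exists, Prod.mk.injEq, YoungDiagram.mem_cells] at hm ⊢
    obtain ⟨a, b, e, ⟨hab, he⟩, rfl, rfl⟩ := hm
    obtain ⟨h1, h2⟩ := h
    simp only at h1 h2
    exact ⟨i', j' / 2, j' % 2, ⟨μ.up_left_mem h1 (by omega) hab, by omega⟩, rfl, by omega⟩

theorem card_double (μ : YoungDiagram) : (double μ).card = 2 * μ.card := by
  change ((μ.cells ×ˢ Finset.range 2).image fun p => (p.1.1, 2 * p.1.2 + p.2)).card = _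
  rw [Finset.card_image_of_injOn, Finset.card_product, Finset.card_range, mul_comm]
  rintro ⟨⟨a, b⟩, e⟩ h ⟨⟨a', b'⟩, e'⟩ h' heq
  simp only [Finset.coe_product, Set.mem_prod, Finset.mem_coe, Finset.mem_range,
    Prod.mk.injEq] at h h' heq ⊢
  omega

/-- The set of Young diagrams with `n` boxes. -/
abbrev Young (n : ℕ) : Type := {μ : YoungDiagram // μ.card = n}

theorem finite_young (n : ℕ) : Finite (Young n) := by
  have hsub : ∀ μ : Young n, μ.1.cells ⊆ Finset.range n ×ˢ Finset.range n := by
    rintro ⟨μ, hμ⟩ ⟨i, j⟩ h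
    rw [YoungDiagram.mem_cells] at h
    have h1 : (Finset.range (i + 1)).image (fun a => (a, j)) ⊆ μ.cells := by
      intro c hc
      obtain ⟨a, ha, rfl⟩ := Finset.mem_image.1 hc
      exact μ.up_left_mem (Nat.lt_succ_iff.1 (Finset.mem_range.1 ha)) le_rfl h
    have h2 : (Finset.range (j + 1)).image (fun a => (i, a)) ⊆ μ.cells := by
      intro c hc
      obtain ⟨a, ha, rfl⟩ := Finset.mem_image.1 hc
      exact μ.up_left_mem le_rfl (Nat.lt_succ_iff.1 (Finset.mem_range.1 ha)) h
    have h3 := Finset.card_le_card h1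
    have h4 := Finset.card_le_card h2
    rw [Finset.card_image_of_injective _ (fun a b hab => (Prod.mk.inj hab).1),
      Finset.card_range] at h3
    rw [Finset.card_image_of_injective _ (fun a b hab => (Prod.mk.inj hab).2),
      Finset.card_range] at h4
    have h5 : μ.cells.card = n := hμ
    simp only [Finset.mem_product, Finset.mem_range]
    omega
  refine Finite.of_injective
    (fun μ : Young n => (⟨μ.1.cells, Finset.mem_powerset.2 (hsub μ)⟩ :
      {s // s ∈ (Finset.range n ×ˢ Finset.range n).powerset})) fun μ ν h => ?_
  exact Subtype.ext (YoungDiagram.ext (Subtype.mk.inj h))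

instance (n : ℕ) : Fintype (Young n) :=
  have := finite_young n
  Fintype.ofFinite _

/-- A numbering of the boxes of `2lam` by the symbols `-n, …, -1, 1, …, n`. -/
def numbering {n : ℕ} (lam : Young n) : Letters n ≃ (double lam.1).cells :=
  Fintype.equivOfCardEq (by
    rw [card_letters, Fintype.card_coe]
    exact (by rw [card_double, lam.2] : (double lam.1).card = 2 * n).symm)

/-- The irreducible character `χ^{2λ}` of `S(2n)` (as a class function it does not depend on the
numbering). -/
def charDouble {n : ℕ} (lam : Young n) (g : Perm (Letters n)) : ℂ :=
  (spechtRep (double lam.1)).character ((numbering lam).permCongr g)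

/-- The dimension `dim 2λ` of the irreducible representation of `S(2n)` attached to `2λ`. -/
def dimDouble {n : ℕ} (lam : Young n) : ℕ := Module.finrank ℂ (spechtModule (double lam.1))

/-! ### Zonal spherical functions and the weights `M_{z,1/2}^{(n)}` -/

/-- The zonal spherical function `w^λ(g) = |H(n)|⁻¹ ∑_{h ∈ H(n)} χ^{2λ}(g h)` of the Gelfand pair
`(S(2n), H(n))`. -/
def zonal {n : ℕ} (lam : Young n) (g : Perm (Letters n)) : ℂ := by
  classical
  exact (Nat.card (hyperoctahedral n) : ℂ)⁻¹ *
    ∑ h : hyperoctahedral n, charDouble lam (g * (h : Perm (Letters n)))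

theorem exists_smul_basePairing {n : ℕ} (x : Pairing n) :
    ∃ g : Perm (Letters n), g • basePairing n = x := by
  classical
  have key : ∀ y : Pairing n,
      (Function.Involutive.toPerm y.partner y.partner_partner).cycleType =
        Multiset.replicate n 2 := by
    intro y
    set σ := Function.Involutive.toPerm y.partner y.partner_partner with hσ
    have hσ2 : σ ^ 2 = 1 := by
      ext i
      rw [pow_two, Perm.mul_apply]
      exact congrArg Subtype.val (y.partner_partner i)
    have h1 : ∀ m ∈ σ.cycleType, m = 2 := by
      intro m hm
      have h2 := Perm.two_le_of_mem_cycleType hm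
      have h3 := (Perm.dvd_of_mem_cycleType hm).trans (orderOf_dvd_of_pow_eq_one hσ2)
      exact le_antisymm (Nat.le_of_dvd (by norm_num) h3) h2
    have h4 := Multiset.eq_replicate_card.2 h1
    have h5 : σ.cycleType.sum = 2 * n := by
      rw [Perm.sum_cycleType, ← card_letters n, ← Finset.card_univ]
      congr 1
      ext i
      simp only [Perm.mem_support, Finset.mem_univ, iff_true]
      exact y.partner_ne i
    rw [h4, Multiset.sum_replicate, smul_eq_mul] at h5
    rw [h4, show σ.cycleType.card = n by omega]
  have hconj := Perm.isConj_iff_cycleType_eq.2 ((key (basePairing n)).trans (key x).symm)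
  obtain ⟨c, hc⟩ := isConj_iff.1 hconj
  refine ⟨c, Pairing.ext (funext fun i => ?_)⟩
  exact congrArg (fun τ : Perm (Letters n) => τ i) hc

/-- The function on `X(n) = H(n) \ S(2n)` induced by a function on `S(2n)` that is constant on the
cosets: its value at `x` is the value at any `g` carrying the base pairing to `x`. -/
def descend {n : ℕ} (f : Perm (Letters n) → ℂ) (x : Pairing n) : ℂ :=
  f (exists_smul_basePairing x).choose

/-- The inner product of `L²(X(n), μ₁^{(n)})`, where `μ₁^{(n)}` is the uniform distribution. -/
def innerX {n : ℕ} (f₁ f₂ : Pairing n → ℂ) : ℂ :=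
  (Fintype.card (Pairing n) : ℂ)⁻¹ * ∑ x, f₁ x * (starRingEnd ℂ) (f₂ x)

/-- The function `F_z^{(n)}(x) = ((1 · 3 ⋯ (2n-1)) / (t (t+2) ⋯ (t+2n-2)))^{1/2} z^{[x]ₙ}` on `X(n)`,
with `t = |z|²`. -/
def Fz (z : ℂ) (n : ℕ) (x : Pairing n) : ℂ :=
  (√((∏ k ∈ Finset.range n, (2 * (k : ℝ) + 1)) /
    ∏ k ∈ Finset.range n, (‖z‖ ^ 2 + 2 * (k : ℝ))) : ℝ) * z ^ x.circles

/-- The normalized zonal spherical function `(dim 2λ)^{1/2} w^λ`, as a function on `X(n)`. -/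
def zonalNormalized {n : ℕ} (lam : Young n) (x : Pairing n) : ℂ :=
  (√(dimDouble lam : ℝ) : ℝ) * descend (zonal lam) x

/-- The `z`-measure `M_{z,1/2}^{(n)}(λ) = |(F_z^{(n)}, (dim 2λ)^{1/2} w^λ)|²`. -/
def zMeasure (z : ℂ) {n : ℕ} (lam : Young n) : ℝ :=
  ‖innerX (Fz z n) (zonalNormalized lam)‖ ^ 2

end GelfandZ

end

/-! For `g` in $S(2n)$ the cocycle depends only on the projection to $X(n)$, so $\varphi_z(g)$ is a
finite sum. Since $t^{[x]}=z^{[x]}\bar z^{[x]}$, this sum is the inner product of the translate of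
$F_z^{(n)}$ by `g` with $F_z^{(n)}$ itself (`sphericalFun_eq_innerX`). The number of cycles is
invariant under $H(n)$, so $F_z^{(n)}$ lifts to an $H(n)$-bi-invariant function on $S(2n)$ and
expands as $\sum_\lambda d_\lambda w^\lambda$.

The $w^\lambda$ are real, invariant under $g\mapsto g^{-1}$, and satisfy $w^\lambda *
w^\mu=\delta_{\lambda\mu}\frac{|S(2n)|}{\dim 2\lambda}w^\lambda$ (`zonalElt_mul_zonalElt`). Hence
the inner product above equals $\sum_\lambda\frac{|d_\lambda|^2}{\dim 2\lambda}w^\lambda(g)$, and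
$|d_\lambda|^2/\dim 2\lambda$ is the squared modulus of the inner product of $F_z^{(n)}$ with $(\dim
2\lambda)^{1/2}w^\lambda$ (`zMeasure_eq`). Evaluating at the identity, where $\varphi_z$ and all
$w^\lambda$ equal $1$, gives total mass $1$.

The harmonic analysis takes place in the group algebra. A Young symmetrizer $c$ satisfies
$cxc\in\mathbb Cc$ for all $x$, so with $c^2=kc$ the central element $\sum_u ucu^{-1}$ is $k$ times
the character of the ideal generated by $c$; multiplying by the idempotent $E$ of $H(n)$ and by
$k^{-1}$ gives $w^\lambda$. Different shapes give orthogonal elements by the dominance argument, and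
the shape $2\lambda$ gives a nonzero one because a suitable coefficient is an average of nonnegative
integers, one of which is $1$ (`subgroupAvg_mul_conjSum_ne_zero`).

Spanning is a count: the orbits of $H(n)$ on $X(n)$ are separated by Young diagrams with $n$ boxes
(`exists_orbit_type`), so as many independent bi-invariant functions as there are diagrams must span
(`exists_zonal_expansion`). Completeness of the list of irreducible representations is never needed.
The line of $H(n)$-fixed vectors is a consequence of the spanning, and it yields $w^\lambda(e)=1$
(`coeff_one_zonalElt`). -/

noncomputable section

namespace GelfandZ

/-! ### Minimal quasi-idempotents in a group algebra -/

section GroupAlgebra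

variable {G : Type*} [Group G]

theorem coeff_of_mul (g h : G) (x : MonoidAlgebra ℂ G) :
    (MonoidAlgebra.of ℂ G g * x).coeff h = x.coeff (g⁻¹ * h) := by
  rw [MonoidAlgebra.of_apply, MonoidAlgebra.coeff_single_mul_apply, one_mul]

theorem coeff_mul_of (g h : G) (x : MonoidAlgebra ℂ G) :
    (x * MonoidAlgebra.of ℂ G g).coeff h = x.coeff (h * g⁻¹) := by
  rw [MonoidAlgebra.of_apply, MonoidAlgebra.coeff_mul_single_apply, mul_one]

theorem coeff_of (g : G) : (MonoidAlgebra.of ℂ G g).coeff = Finsupp.single g 1 := by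
  rw [MonoidAlgebra.of_apply, MonoidAlgebra.coeff_single]

variable [Fintype G]

theorem sum_coeff_smul_of (x : MonoidAlgebra ℂ G) :
    ∑ g, x.coeff g • MonoidAlgebra.of ℂ G g = x := by
  classical
  refine MonoidAlgebra.ext (Finsupp.ext fun h => ?_)
  simp

/-- Convolution is written with $u^{-1}$ in the second factor: when `y` has real coefficients
invariant under inversion, as the zonal elements do, the right side is an inner product of a
translate of `x` with `y`. -/
theorem coeff_mul_eq_sum (x y : MonoidAlgebra ℂ G) (g : G) :
    (x * y).coeff g = ∑ u, x.coeff (g * u) * y.coeff u⁻¹ := by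
  conv_lhs => rw [← sum_coeff_smul_of x]
  rw [Finset.sum_mul, MonoidAlgebra.coeff_sum, Finsupp.finsetSum_apply]
  refine (Fintype.sum_equiv (Equiv.mulLeft g) _ _ fun u => ?_).symm
  simp only [Equiv.coe_mulLeft, smul_mul_assoc, MonoidAlgebra.coeff_smul, Finsupp.smul_apply,
    smul_eq_mul, coeff_of_mul]
  congr 2
  group

theorem coeff_mul_one_comm (x y : MonoidAlgebra ℂ G) : (x * y).coeff 1 = (y * x).coeff 1 := by
  rw [coeff_mul_eq_sum, coeff_mul_eq_sum]
  refine Fintype.sum_equiv (Equiv.inv G) _ _ fun u => ?_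
  simp [mul_comm]

/-- The trace of an endomorphism of the group algebra, in the basis of group elements. -/
theorem trace_eq_sum_coeff (f : MonoidAlgebra ℂ G →ₗ[ℂ] MonoidAlgebra ℂ G) :
    LinearMap.trace ℂ _ f = ∑ u, (f (MonoidAlgebra.of ℂ G u)).coeff u := by
  classical
  rw [LinearMap.trace_eq_matrix_trace ℂ (MonoidAlgebra.basis G ℂ), Matrix.trace]
  refine Finset.sum_congr rfl fun u _ => ?_
  rw [Matrix.diag_apply, LinearMap.toMatrix_apply, MonoidAlgebra.basis_apply]
  rfl

/-! ### Central elements obtained by summing conjugates -/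

/-- The sum of the conjugates of an element of the group algebra. -/
def conjSum (c : MonoidAlgebra ℂ G) : MonoidAlgebra ℂ G :=
  ∑ u, MonoidAlgebra.of ℂ G u * c * MonoidAlgebra.of ℂ G u⁻¹

theorem coeff_conjSum (c : MonoidAlgebra ℂ G) (g : G) :
    (conjSum c).coeff g = ∑ u, c.coeff (u⁻¹ * g * u) := by
  simp only [conjSum, MonoidAlgebra.coeff_sum, Finsupp.finsetSum_apply, coeff_mul_of,
    coeff_of_mul, inv_inv, mul_assoc]

theorem of_mul_conjSum (c : MonoidAlgebra ℂ G) (g : G) :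
    MonoidAlgebra.of ℂ G g * conjSum c = conjSum c * MonoidAlgebra.of ℂ G g := by
  simp only [conjSum, Finset.mul_sum, Finset.sum_mul]
  refine Fintype.sum_equiv (Equiv.mulLeft g) _ _ fun u => ?_
  simp only [Equiv.coe_mulLeft, mul_inv_rev, map_mul, mul_assoc]
  rw [← map_mul (MonoidAlgebra.of ℂ G) g⁻¹ g, inv_mul_cancel, map_one, mul_one]

theorem mul_conjSum (c x : MonoidAlgebra ℂ G) : x * conjSum c = conjSum c * x := by
  rw [← sum_coeff_smul_of x, Finset.sum_mul, Finset.mul_sum]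
  exact Finset.sum_congr rfl fun g _ => by
    rw [smul_mul_assoc, mul_smul_comm, of_mul_conjSum]

/-- A central factor passes through each conjugation. Products of central elements thereby reduce to
computations with the single element `c`. -/
theorem mul_conjSum_of_commute {a : MonoidAlgebra ℂ G} (ha : ∀ x, x * a = a * x)
    (c : MonoidAlgebra ℂ G) : a * conjSum c = conjSum (a * c) := by
  simp only [conjSum, Finset.mul_sum]
  exact Finset.sum_congr rfl fun u _ => by rw [← mul_assoc, ← mul_assoc, ← mul_assoc, ← ha]

theorem conjSum_smul (r : ℂ) (c : MonoidAlgebra ℂ G) : conjSum (r • c) = r • conjSum c := by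
  simp only [conjSum, Finset.smul_sum, mul_smul_comm, smul_mul_assoc]

theorem conjSum_zero : conjSum (0 : MonoidAlgebra ℂ G) = 0 := by simp [conjSum]

/-- An element `c` of the group algebra, with coefficient `1` at the identity, such that every
`c x c` is a multiple of `c`. -/
structure IsMinimalSymmetrizer (c : MonoidAlgebra ℂ G) : Prop where
  coeff_one : c.coeff 1 = 1
  sandwich : ∀ x, ∃ r : ℂ, c * x * c = r • c

/-- The scalar `k` with `c² = k c`. -/
def symmetrizerScalar (c : MonoidAlgebra ℂ G) : ℂ := (c * c).coeff 1

namespace IsMinimalSymmetrizer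

variable {c : MonoidAlgebra ℂ G} (hc : IsMinimalSymmetrizer c)

include hc

omit [Fintype G] in
theorem mul_mul (x : MonoidAlgebra ℂ G) : c * x * c = (c * x * c).coeff 1 • c := by
  obtain ⟨r, hr⟩ := hc.sandwich x
  rw [hr, MonoidAlgebra.coeff_smul, Finsupp.smul_apply, hc.coeff_one, smul_eq_mul, mul_one]

omit [Fintype G] in
theorem mul_self : c * c = symmetrizerScalar c • c := by
  simpa [symmetrizerScalar] using hc.mul_mul 1

/-- By minimality $cu^{-1}c$ is a multiple of $c$, and the trace property of the coefficient at the
identity shows that the factor is the coefficient of $c^2$ at $u$. Summing over $u$ reassembles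
$c^2\cdot c=k^2c$. -/
theorem conjSum_mul_self : conjSum c * c = symmetrizerScalar c ^ 2 • c := by
  have h : ∀ u, MonoidAlgebra.of ℂ G u * c * MonoidAlgebra.of ℂ G u⁻¹ * c =
      ((c * c).coeff u • MonoidAlgebra.of ℂ G u) * c := by
    intro u
    rw [mul_assoc, mul_assoc, ← mul_assoc c, hc.mul_mul, coeff_mul_one_comm, ← mul_assoc,
      coeff_mul_of, inv_inv, one_mul, mul_smul_comm, smul_mul_assoc]
  rw [conjSum, Finset.sum_mul, Finset.sum_congr rfl fun u _ => h u, ← Finset.sum_mul,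
    sum_coeff_smul_of, hc.mul_self, smul_mul_assoc, hc.mul_self, smul_smul, sq]

theorem conjSum_mul_conjSum :
    conjSum c * conjSum c = symmetrizerScalar c ^ 2 • conjSum c := by
  rw [mul_conjSum_of_commute (mul_conjSum c), hc.conjSum_mul_self, conjSum_smul]

theorem conjSum_coeff_one : (conjSum c).coeff 1 = Fintype.card G := by
  simp [coeff_conjSum, hc.coeff_one]

theorem trace_mulRight :
    LinearMap.trace ℂ _ (LinearMap.mulRight ℂ c) = Fintype.card G := by
  simp [trace_eq_sum_coeff, coeff_of_mul, hc.coeff_one, -MonoidAlgebra.of_apply]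

/-- If $c^2=0$, right multiplication by $c$ would be nilpotent and have trace zero. Its diagonal
entries in the basis of group elements are all $1$, so its trace is $|G|$. -/
theorem scalar_ne_zero : symmetrizerScalar c ≠ 0 := by
  intro h
  have h1 : IsNilpotent (LinearMap.mulRight ℂ c) := ⟨2, by
    refine LinearMap.ext fun x => ?_
    rw [sq, Module.End.mul_apply, LinearMap.mulRight_apply, LinearMap.mulRight_apply, mul_assoc,
      hc.mul_self, h, zero_smul, mul_zero, LinearMap.zero_apply]⟩
  have h2 := (LinearMap.isNilpotent_trace_of_isNilpotent h1).eq_zero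
  rw [hc.trace_mulRight] at h2
  exact Fintype.card_ne_zero (Nat.cast_eq_zero.1 h2)

/-- Right multiplication by $k^{-1}c$ is a projection onto the left ideal generated by $c$. -/
theorem smul_mul_of_mem_range {x : MonoidAlgebra ℂ G}
    (hx : x ∈ LinearMap.range (LinearMap.mulRight ℂ c)) :
    (symmetrizerScalar c)⁻¹ • (x * c) = x := by
  obtain ⟨y, rfl⟩ := hx
  rw [LinearMap.mulRight_apply, mul_assoc, hc.mul_self, mul_smul_comm, smul_smul,
    inv_mul_cancel₀ hc.scalar_ne_zero, one_smul]

/-- The trace of left multiplication by a group element on the left ideal generated by `c`. -/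
theorem trace_restrict (g : G)
    (h : ∀ v ∈ LinearMap.range (LinearMap.mulRight ℂ c),
      LinearMap.mulLeft ℂ (MonoidAlgebra.of ℂ G g) v ∈ LinearMap.range (LinearMap.mulRight ℂ c)) :
    LinearMap.trace ℂ _ ((LinearMap.mulLeft ℂ (MonoidAlgebra.of ℂ G g)).restrict h) =
      (symmetrizerScalar c)⁻¹ * (conjSum c).coeff g⁻¹ := by
  let p := LinearMap.range (LinearMap.mulRight ℂ c)
  let F : MonoidAlgebra ℂ G →ₗ[ℂ] MonoidAlgebra ℂ G := (symmetrizerScalar c)⁻¹ •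
    (LinearMap.mulRight ℂ c ∘ₗ LinearMap.mulLeft ℂ (MonoidAlgebra.of ℂ G g))
  have hF : ∀ x, F x = (symmetrizerScalar c)⁻¹ • (MonoidAlgebra.of ℂ G g * x * c) := fun _ => rfl
  have hFp : ∀ x, F x ∈ p := fun x => p.smul_mem _ ⟨_, rfl⟩
  have h1 : (LinearMap.mulLeft ℂ (MonoidAlgebra.of ℂ G g)).restrict h =
      F.codRestrict p hFp ∘ₗ p.subtype := by
    refine LinearMap.ext fun v => Subtype.ext ?_
    change MonoidAlgebra.of ℂ G g * v.1 = F v.1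
    rw [hF, mul_assoc, ← mul_smul_comm, hc.smul_mul_of_mem_range v.2]
  -- Cyclicity of the trace replaces the trace on the ideal by that of $x\mapsto k^{-1}gxc$ on the
  -- whole group algebra, where group elements form a basis.
  rw [h1, LinearMap.trace_comp_comm']
  change LinearMap.trace ℂ _ F = _
  rw [trace_eq_sum_coeff, coeff_conjSum, Finset.mul_sum]
  refine Finset.sum_congr rfl fun u _ => ?_
  rw [hF, MonoidAlgebra.coeff_smul, Finsupp.smul_apply, ← map_mul, coeff_of_mul, smul_eq_mul,
    mul_inv_rev]

/-- The dimension of the ideal is the trace of the identity element on it. -/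
theorem scalar_mul_finrank : symmetrizerScalar c *
    Module.finrank ℂ (LinearMap.range (LinearMap.mulRight ℂ c)) = Fintype.card G := by
  have h := hc.trace_restrict 1 fun v hv => by
    rwa [map_one, LinearMap.mulLeft_apply, one_mul]
  rw [inv_one, hc.conjSum_coeff_one] at h
  have h2 : (LinearMap.mulLeft ℂ (MonoidAlgebra.of ℂ G 1)).restrict (fun v hv => by
      rwa [map_one, LinearMap.mulLeft_apply, one_mul]) =
      (LinearMap.id : LinearMap.range (LinearMap.mulRight ℂ c) →ₗ[ℂ] _) :=
    LinearMap.ext fun v => Subtype.ext (by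
      change MonoidAlgebra.of ℂ G 1 * v.1 = v.1
      rw [map_one, one_mul])
  rw [h2, LinearMap.trace_id] at h
  rw [h, mul_inv_cancel_left₀ hc.scalar_ne_zero]

/-- Central elements act on `conjSum c` by scalars. -/
theorem exists_central_mul {a : MonoidAlgebra ℂ G} (ha : ∀ x, x * a = a * x) :
    ∃ θ : ℂ, a * conjSum c = θ • conjSum c := by
  obtain ⟨r, hr⟩ := hc.sandwich a
  have h : a * c = ((symmetrizerScalar c)⁻¹ * r) • c := by
    rw [mul_smul, ← hr, ha c, mul_assoc, hc.mul_self, mul_smul_comm, smul_smul,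
      inv_mul_cancel₀ hc.scalar_ne_zero, one_smul]
  exact ⟨_, by rw [mul_conjSum_of_commute ha, h, conjSum_smul]⟩

end IsMinimalSymmetrizer

end GroupAlgebra

/-! ### Row and column combinatorics of tableaux -/

section Tableaux

variable {α : Type*} [Fintype α] {μ ν : YoungDiagram}

/-- The row of an entry of a tableau. -/
def rowOf (T : α ≃ μ.cells) (i : α) : ℕ := (T i).1.1

/-- The column of an entry of a tableau. -/
def colOf (T : α ≃ μ.cells) (i : α) : ℕ := (T i).1.2

omit [Fintype α] in
theorem eq_of_rowOf_colOf (T : α ≃ μ.cells) {i j : α} (hr : rowOf T i = rowOf T j)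
    (hc : colOf T i = colOf T j) : i = j :=
  T.injective (Subtype.ext (Prod.ext hr hc))

omit [Fintype α] in
theorem rowOf_colOf_mem (T : α ≃ μ.cells) (i : α) : (rowOf T i, colOf T i) ∈ μ :=
  (YoungDiagram.mem_cells _).1 (T i).2

omit [Fintype α] in
theorem exists_rowOf_colOf (T : α ≃ μ.cells) {a b : ℕ} (h : (a, b) ∈ μ) :
    ∃ i, rowOf T i = a ∧ colOf T i = b :=
  ⟨T.symm ⟨(a, b), (YoungDiagram.mem_cells _).2 h⟩, by simp [rowOf], by simp [colOf]⟩

/-- If entries in the same row of `T` lie in different columns of `T'`, then each column of `T'`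
has at most as many entries in the first `m` rows of `T` as in the first `m` rows of `T'`. -/
theorem card_col_row_le (T : α ≃ μ.cells) (T' : α ≃ ν.cells)
    (h : ∀ i j, rowOf T i = rowOf T j → colOf T' i = colOf T' j → i = j) (m j : ℕ) :
    (Finset.univ.filter fun i => rowOf T i < m ∧ colOf T' i = j).card ≤
      (Finset.univ.filter fun i => rowOf T' i < m ∧ colOf T' i = j).card := by
  classical
  -- If column `j` of `T'` reaches row `m`, its first `m` rows contain `m` entries, while the left
  -- side is at most `m` because entries of one column of `T'` lie in distinct rows of `T`.
  -- Otherwise the whole column lies in the first `m` rows and the inequality is an inclusion.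
  by_cases hm : ∃ i, colOf T' i = j ∧ m ≤ rowOf T' i
  · obtain ⟨i₀, h1, h2⟩ := hm
    calc _ ≤ (Finset.range m).card := by
          refine Finset.card_le_card_of_injOn (rowOf T) ?_ ?_
          · intro i hi
            simpa using (Finset.mem_filter.1 hi).2.1
          · intro i hi i' hi' he
            exact h i i' he ((Finset.mem_filter.1 hi).2.2.trans (Finset.mem_filter.1 hi').2.2.symm)
      _ ≤ _ := by
          have hmem : ∀ a, a < m → ∃ i, rowOf T' i = a ∧ colOf T' i = j := fun a ha =>
            exists_rowOf_colOf T' (ν.up_left_mem (ha.le.trans h2) h1.ge (rowOf_colOf_mem T' i₀))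
          have : Nonempty α := ⟨i₀⟩
          choose! f hf1 hf2 using hmem
          refine Finset.card_le_card_of_injOn f ?_ ?_
          · intro a ha
            have ha' : a < m := by simpa using ha
            simp [hf1 a ha', hf2 a ha', ha']
          · intro a ha b hb he
            have ha' : a < m := by simpa using ha
            have hb' : b < m := by simpa using hb
            rw [← hf1 a ha', ← hf1 b hb', he]
  · push Not at hm
    refine Finset.card_le_card fun i hi => ?_
    have := (Finset.mem_filter.1 hi).2
    simp [this.2, hm i this.2]

theorem card_row_eq_sum (κ : α → ℕ) (ρ : α → ℕ) (m : ℕ) :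
    (Finset.univ.filter fun i => ρ i < m).card =
      ∑ j ∈ Finset.univ.image κ, (Finset.univ.filter fun i => ρ i < m ∧ κ i = j).card := by
  classical
  rw [Finset.card_eq_sum_card_fiberwise (f := κ) (t := Finset.univ.image κ)
    fun i _ => by simp]
  exact Finset.sum_congr rfl fun j _ => by rw [Finset.filter_filter]

theorem card_row_le (T : α ≃ μ.cells) (T' : α ≃ ν.cells)
    (h : ∀ i j, rowOf T i = rowOf T j → colOf T' i = colOf T' j → i = j) (m : ℕ) :
    (Finset.univ.filter fun i => rowOf T i < m).card ≤
      (Finset.univ.filter fun i => rowOf T' i < m).card := by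
  rw [card_row_eq_sum (colOf T') (rowOf T), card_row_eq_sum (colOf T') (rowOf T')]
  exact Finset.sum_le_sum fun j _ => card_col_row_le T T' h m j

theorem card_rowOf_lt (T : α ≃ μ.cells) (m : ℕ) :
    (Finset.univ.filter fun i => rowOf T i < m).card = ∑ i ∈ Finset.range m, μ.rowLen i := by
  classical
  rw [Finset.card_eq_sum_card_fiberwise (f := rowOf T) (t := Finset.range m)
    fun i hi => by simpa using hi]
  refine Finset.sum_congr rfl fun r hr => ?_
  rw [Finset.filter_filter, YoungDiagram.rowLen_eq_card]
  refine Finset.card_bij (fun i _ => (T i).1) ?_ ?_ ?_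
  · intro i hi
    exact YoungDiagram.mem_row_iff.2 ⟨rowOf_colOf_mem T i, (Finset.mem_filter.1 hi).2.2⟩
  · intro i _ j _ he
    exact T.injective (Subtype.ext he)
  · rintro ⟨a, b⟩ hb
    obtain ⟨h1, h2⟩ := YoungDiagram.mem_row_iff.1 hb
    obtain ⟨i, hi1, hi2⟩ := exists_rowOf_colOf T h1
    have hr' : r < m := by simpa using hr
    refine ⟨i, ?_, Prod.ext hi1 hi2⟩
    have : rowOf T i = r := hi1.trans h2
    simp [this, hr']

theorem card_rowOf_lt_eq (T T' : α ≃ μ.cells) (m : ℕ) :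
    (Finset.univ.filter fun i => rowOf T i < m).card =
      (Finset.univ.filter fun i => rowOf T' i < m).card := by
  rw [card_rowOf_lt, card_rowOf_lt]

/-- Antisymmetry of the dominance order. -/
theorem eq_of_dominance
    (h : ∀ m, ∑ i ∈ Finset.range m, μ.rowLen i = ∑ i ∈ Finset.range m, ν.rowLen i) : μ = ν := by
  have h1 : ∀ i, μ.rowLen i = ν.rowLen i := fun i => by
    have h2 := h (i + 1)
    rw [Finset.sum_range_succ, Finset.sum_range_succ, h i] at h2
    omega
  refine YoungDiagram.ext (Finset.ext fun ⟨a, b⟩ => ?_)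
  rw [YoungDiagram.mem_cells, YoungDiagram.mem_cells, YoungDiagram.mem_iff_lt_rowLen,
    YoungDiagram.mem_iff_lt_rowLen, h1]

/-- For two tableaux of different shapes, in one order, some two entries are in the same row of the
one and the same column of the other. -/
theorem exists_row_col_of_ne (T : α ≃ μ.cells) (T' : α ≃ ν.cells) (hne : μ ≠ ν) :
    (∀ g : Perm α, ∃ i j, i ≠ j ∧ rowOf T i = rowOf T j ∧ colOf T' (g i) = colOf T' (g j)) ∨
    (∀ g : Perm α, ∃ i j, i ≠ j ∧ rowOf T' i = rowOf T' j ∧ colOf T (g i) = colOf T (g j)) := by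
  by_contra hcon
  push Not at hcon
  obtain ⟨⟨g, hg⟩, ⟨g', hg'⟩⟩ := hcon
  refine hne (eq_of_dominance fun m => le_antisymm ?_ ?_)
  -- If both alternatives fail, each shape dominates the other, and the shapes agree.
  · have := card_row_le T (g.trans T') (fun i j h1 h2 => by
      by_contra h3
      exact hg i j h3 h1 h2) m
    rwa [card_rowOf_lt, card_rowOf_lt] at this
  · have := card_row_le T' (g'.trans T) (fun i j h1 h2 => by
      by_contra h3
      exact hg' i j h3 h1 h2) m
    rwa [card_rowOf_lt, card_rowOf_lt] at this

/-- A permutation under which no two entries of the same row go to the same column is the product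
of a row and a column permutation. -/
theorem exists_row_perm (T : α ≃ μ.cells) (g : Perm α)
    (h : ∀ i j, rowOf T i = rowOf T j → colOf T (g i) = colOf T (g j) → i = j) :
    ∃ s : Perm α, (∀ i, rowOf T (s i) = rowOf T i) ∧ ∀ i, colOf T (s i) = colOf T (g i) := by
  classical
  let T' : α ≃ μ.cells := g.trans T
  -- The row permutation should send `i` to the cell in its own row and in the column of `g i`. The
  -- difficulty is that this cell lies in the diagram; injectivity is the hypothesis.
  have hmem : ∀ i, (rowOf T i, colOf T' i) ∈ μ := by
    intro i
    by_contra hi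
    set m := rowOf T i with hm
    set j := colOf T' i with hj
    have h1 := card_rowOf_lt_eq T T' m
    rw [card_row_eq_sum (colOf T') (rowOf T), card_row_eq_sum (colOf T') (rowOf T')] at h1
    -- The two tableaux have the same shape, so the column counts have equal totals and each
    -- columnwise inequality is an equality.
    have h2 := (Finset.sum_eq_sum_iff_of_le fun j _ => card_col_row_le T T' h m j).1 h1 j
      (Finset.mem_image.2 ⟨i, Finset.mem_univ _, rfl⟩)
    -- If the cell is missing, column `j` of `T'` stops before row `m`, so passing from `m` to `m +
    -- 1` rows adds nothing on the side of `T'`. On the side of `T` it adds at least the entry `i`.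
    have h3 : (Finset.univ.filter fun i => rowOf T i < m + 1 ∧ colOf T' i = j).card ≤
        (Finset.univ.filter fun i => rowOf T' i < m ∧ colOf T' i = j).card := by
      refine (card_col_row_le T T' h (m + 1) j).trans (Finset.card_le_card fun k hk => ?_)
      have hk' := (Finset.mem_filter.1 hk).2
      have : rowOf T' k < m := by
        by_contra hlt
        exact hi (μ.up_left_mem (not_lt.1 hlt) hk'.2.ge (rowOf_colOf_mem T' k))
      simp [this, hk'.2]
    rw [← h2] at h3
    refine absurd h3 (not_le.2 (Finset.card_lt_card ?_))
    refine Finset.ssubset_iff_subset_ne.2 ⟨fun k hk => ?_, fun he => ?_⟩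
    · have hk' := (Finset.mem_filter.1 hk).2
      simp [hk'.2, hk'.1.le]
    · have : i ∈ Finset.univ.filter fun i => rowOf T i < m + 1 ∧ colOf T' i = j := by
        simp [← hm, ← hj]
      rw [← he] at this
      exact lt_irrefl _ (Finset.mem_filter.1 this).2.1
  let S : α → μ.cells := fun i => ⟨(rowOf T i, colOf T' i), (YoungDiagram.mem_cells _).2 (hmem i)⟩
  have hS : Function.Injective S := fun i j hij => by
    have h1 := Prod.mk.inj (Subtype.mk.inj hij)
    exact h i j h1.1 h1.2
  have hS' : Function.Injective (fun i => T.symm (S i)) := T.symm.injective.comp hS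
  refine ⟨Equiv.ofBijective _ (Finite.injective_iff_bijective.1 hS'), fun i => ?_, fun i => ?_⟩
  · simp [rowOf, S]
  · simp [colOf, S, T']

end Tableaux

/-! ### Young symmetrizers on an arbitrary set of entries -/

section Symmetrizers

variable {α : Type*} [Fintype α] [DecidableEq α]

/-- The sum of the permutations preserving a function. -/
def stabSum (ρ : α → ℕ) : MonoidAlgebra ℂ (Perm α) :=
  ∑ σ : Perm α with ∀ i, ρ (σ i) = ρ i, MonoidAlgebra.of ℂ _ σ

/-- The signed sum of the permutations preserving a function. -/
def stabAlt (κ : α → ℕ) : MonoidAlgebra ℂ (Perm α) :=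
  ∑ σ : Perm α with ∀ i, κ (σ i) = κ i, ((Perm.sign σ : ℤ) : ℂ) • MonoidAlgebra.of ℂ _ σ

theorem stabSum_mul_of {ρ : α → ℕ} {s : Perm α} (hs : ∀ i, ρ (s i) = ρ i) :
    stabSum ρ * MonoidAlgebra.of ℂ _ s = stabSum ρ := by
  rw [stabSum, Finset.sum_mul]
  refine Finset.sum_equiv (Equiv.mulRight s) (fun σ => ?_) fun σ _ => by
    rw [← map_mul]; rfl
  simp only [Finset.mem_filter, Finset.mem_univ, true_and, Equiv.coe_mulRight, Perm.mul_apply]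
  refine ⟨fun h i => by rw [h, hs], fun h i => ?_⟩
  have := h (s⁻¹ i)
  rw [← hs (s⁻¹ i)] at this
  simpa using this

theorem of_mul_stabAlt {κ : α → ℕ} {s : Perm α} (hs : ∀ i, κ (s i) = κ i) :
    MonoidAlgebra.of ℂ _ s * stabAlt κ = ((Perm.sign s : ℤ) : ℂ) • stabAlt κ := by
  rw [stabAlt, Finset.mul_sum, Finset.smul_sum]
  refine Finset.sum_equiv (Equiv.mulLeft s) (fun σ => ?_) fun σ _ => ?_
  · simp only [Finset.mem_filter, Finset.mem_univ, true_and, Equiv.coe_mulLeft, Perm.mul_apply, hs]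
  · simp only [Equiv.coe_mulLeft, map_mul, smul_smul, mul_smul_comm, Units.val_mul, Int.cast_mul]
    rw [← mul_assoc, ← Int.cast_mul, ← Units.val_mul, Int.units_mul_self, Units.val_one,
      Int.cast_one, one_mul]

/-- If `i`, `j` have the same value under `ρ`, and under `κ ∘ g⁻¹`, the product vanishes. -/
theorem stabSum_mul_of_mul_stabAlt_eq_zero {ρ κ : α → ℕ} (g : Perm α) {i j : α} (hij : i ≠ j)
    (hρ : ρ i = ρ j) (hκ : κ (g⁻¹ i) = κ (g⁻¹ j)) :
    stabSum ρ * MonoidAlgebra.of ℂ _ g * stabAlt κ = 0 := by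
  have key : ∀ (f : α → ℕ) (a b : α), f a = f b → ∀ k, f (swap a b k) = f k := by
    intro f a b h k
    by_cases h1 : k = a
    · subst h1; rw [swap_apply_left, h]
    by_cases h2 : k = b
    · subst h2; rw [swap_apply_right, h]
    rw [swap_apply_of_ne_of_ne h1 h2]
  have h1 : swap i j * g = g * swap (g⁻¹ i) (g⁻¹ j) := by
    rw [mul_swap_eq_swap_mul]; simp
  -- The row sum absorbs the transposition of `i` and `j`; moved past `g`, it becomes a column
  -- transposition, which the alternating sum absorbs with sign $-1$.
  have h2 : stabSum ρ * MonoidAlgebra.of ℂ _ g * stabAlt κ =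
      -(stabSum ρ * MonoidAlgebra.of ℂ _ g * stabAlt κ) := by
    conv_lhs => rw [← stabSum_mul_of (key ρ i j hρ), mul_assoc (stabSum ρ), ← map_mul, h1, map_mul,
      ← mul_assoc (stabSum ρ), mul_assoc, of_mul_stabAlt (key κ _ _ hκ),
      Perm.sign_swap (fun h => hij (g⁻¹.injective h))]
    simp
  have h3 : (2 : ℂ) • (stabSum ρ * MonoidAlgebra.of ℂ _ g * stabAlt κ) = 0 := by
    rw [two_smul]
    nth_rewrite 1 [h2]
    exact neg_add_cancel _
  exact (smul_eq_zero.1 h3).resolve_left two_ne_zero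

variable {μ ν : YoungDiagram}

/-- The Young symmetrizer of a tableau. -/
def youngSymmetrizer (T : α ≃ μ.cells) : MonoidAlgebra ℂ (Perm α) :=
  stabSum (rowOf T) * stabAlt (colOf T)

/-- By linearity `x` may be a group element $g$. Either $g^{-1}$ sends two entries of one row to one
column and the product vanishes, or some row permutation $s$ makes $sg$ a column permutation; then
$s$ is absorbed on the left and $sg$ on the right up to its sign. -/
theorem stabSum_mul_mul_stabAlt (T : α ≃ μ.cells) (x : MonoidAlgebra ℂ (Perm α)) :
    ∃ r : ℂ, stabSum (rowOf T) * x * stabAlt (colOf T) = r • youngSymmetrizer T := by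
  have h1 : ∀ g : Perm α, ∃ r : ℂ, stabSum (rowOf T) * MonoidAlgebra.of ℂ _ g * stabAlt (colOf T) =
      r • youngSymmetrizer T := by
    intro g
    by_cases h : ∀ i j, rowOf T i = rowOf T j → colOf T (g⁻¹ i) = colOf T (g⁻¹ j) → i = j
    · obtain ⟨s, hs1, hs2⟩ := exists_row_perm T g⁻¹ h
      refine ⟨(Perm.sign (s * g) : ℤ), ?_⟩
      have h2 : stabSum (rowOf T) * MonoidAlgebra.of ℂ _ g =
          stabSum (rowOf T) * MonoidAlgebra.of ℂ _ (s * g) := by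
        rw [map_mul, ← mul_assoc, stabSum_mul_of hs1]
      rw [h2, mul_assoc, of_mul_stabAlt, mul_smul_comm, youngSymmetrizer]
      intro i
      rw [Perm.mul_apply, hs2]; simp
    · push Not at h
      obtain ⟨i, j, h3, h4, h5⟩ := h
      exact ⟨0, by rw [stabSum_mul_of_mul_stabAlt_eq_zero g h5 h3 h4, zero_smul]⟩
  choose r hr using h1
  refine ⟨∑ g, x.coeff g * r g, ?_⟩
  conv_lhs => rw [← sum_coeff_smul_of x]
  rw [Finset.mul_sum, Finset.sum_mul, Finset.sum_smul]
  exact Finset.sum_congr rfl fun g _ => by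
    rw [mul_smul_comm, smul_mul_assoc, hr, smul_smul]

theorem coeff_youngSymmetrizer (T : α ≃ μ.cells) (g : Perm α) :
    (youngSymmetrizer T).coeff g =
      ∑ s : Perm α with ∀ i, rowOf T (s i) = rowOf T i,
        if ∀ i, colOf T ((s⁻¹ * g) i) = colOf T i then ((Perm.sign (s⁻¹ * g) : ℤ) : ℂ) else 0 := by
  rw [youngSymmetrizer, stabSum, Finset.sum_mul, MonoidAlgebra.coeff_sum, Finsupp.finsetSum_apply]
  refine Finset.sum_congr rfl fun s _ => ?_
  rw [coeff_of_mul, stabAlt, MonoidAlgebra.coeff_sum, Finsupp.finsetSum_apply]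
  simp only [MonoidAlgebra.coeff_smul, Finsupp.smul_apply, coeff_of, Finsupp.single_apply,
    smul_eq_mul, mul_ite, mul_one, mul_zero]
  rw [Finset.sum_ite_eq']
  simp

/-- Only the identity preserves both the rows and the columns. -/
theorem coeff_one_youngSymmetrizer (T : α ≃ μ.cells) : (youngSymmetrizer T).coeff 1 = 1 := by
  rw [coeff_youngSymmetrizer, Finset.sum_eq_single 1]
  · simp
  · intro s hs hne
    refine if_neg fun h => hne ?_
    have hs' := (Finset.mem_filter.1 hs).2
    ext i
    have h1 := h (s i)
    rw [mul_one, show s⁻¹ (s i) = i by simp] at h1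
    exact (eq_of_rowOf_colOf T (hs' i).symm h1).symm
  · intro h
    simp at h

/-- With $c=ab$, row sum times column sum, $cxc=a(bxa)b$ is a multiple of $ab$ by
`stabSum_mul_mul_stabAlt`. -/
theorem isMinimalSymmetrizer_youngSymmetrizer (T : α ≃ μ.cells) :
    IsMinimalSymmetrizer (youngSymmetrizer T) where
  coeff_one := coeff_one_youngSymmetrizer T
  sandwich x := by
    obtain ⟨r, hr⟩ := stabSum_mul_mul_stabAlt T (stabAlt (colOf T) * x * stabSum (rowOf T))
    refine ⟨r, ?_⟩
    rw [← hr]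
    simp only [youngSymmetrizer, mul_assoc]

theorem conj_coeff_youngSymmetrizer (T : α ≃ μ.cells) (g : Perm α) :
    (starRingEnd ℂ) ((youngSymmetrizer T).coeff g) = (youngSymmetrizer T).coeff g := by
  rw [coeff_youngSymmetrizer, map_sum]
  refine Finset.sum_congr rfl fun s _ => ?_
  split_ifs
  · exact map_intCast _ _
  · exact map_zero _

/-- In one of the two orders, every permutation leaves a pair in a common row of one tableau and a
common column of the other, so the row sum, any element and the column sum multiply to zero.
Centrality makes the order of the factors immaterial. -/
theorem conjSum_mul_conjSum_of_ne (T : α ≃ μ.cells) (T' : α ≃ ν.cells) (hne : μ ≠ ν) :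
    conjSum (youngSymmetrizer T) * conjSum (youngSymmetrizer T') = 0 := by
  have key : ∀ {μ ν : YoungDiagram} (T : α ≃ μ.cells) (T' : α ≃ ν.cells),
      (∀ g : Perm α, ∃ i j, i ≠ j ∧ rowOf T i = rowOf T j ∧ colOf T' (g i) = colOf T' (g j)) →
      conjSum (youngSymmetrizer T) * conjSum (youngSymmetrizer T') = 0 := by
    intro μ ν T T' h
    have h1 : ∀ x, stabSum (rowOf T) * x * stabAlt (colOf T') = 0 := by
      intro x
      rw [← sum_coeff_smul_of x, Finset.mul_sum, Finset.sum_mul]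
      refine Finset.sum_eq_zero fun g _ => ?_
      obtain ⟨i, j, h1, h2, h3⟩ := h g⁻¹
      rw [mul_smul_comm, smul_mul_assoc, stabSum_mul_of_mul_stabAlt_eq_zero g h1 h2 h3, smul_zero]
    have h2 : ∀ x, youngSymmetrizer T * x * youngSymmetrizer T' = 0 := by
      intro x
      rw [← h1 (stabAlt (colOf T) * x * stabSum (rowOf T'))]
      simp only [youngSymmetrizer, mul_assoc]
    rw [mul_conjSum_of_commute (mul_conjSum _)]
    have h3 : conjSum (youngSymmetrizer T) * youngSymmetrizer T' = 0 := by
      rw [conjSum, Finset.sum_mul]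
      refine Finset.sum_eq_zero fun u _ => ?_
      rw [mul_assoc, mul_assoc, ← mul_assoc (youngSymmetrizer T), h2, mul_zero]
    rw [h3, conjSum_zero]
  rcases exists_row_col_of_ne T T' hne with h | h
  · exact key T T' h
  · rw [mul_conjSum]
    exact key T' T h

end Symmetrizers

/-! ### Averaging over a subgroup -/

section Average

variable {G : Type*} [Group G] [Fintype G]

/-- The idempotent of a subgroup in the group algebra. -/
def subgroupAvg (H : Subgroup G) : MonoidAlgebra ℂ G := by
  classical
  exact (Nat.card H : ℂ)⁻¹ • ∑ h : H, MonoidAlgebra.of ℂ G h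

theorem coeff_subgroupAvg_mul (H : Subgroup G) [Fintype H] (x : MonoidAlgebra ℂ G) (g : G) :
    (subgroupAvg H * x).coeff g = (Nat.card H : ℂ)⁻¹ * ∑ h : H, x.coeff ((h : G)⁻¹ * g) := by
  rw [subgroupAvg, smul_mul_assoc, MonoidAlgebra.coeff_smul, Finsupp.smul_apply, Finset.sum_mul,
    MonoidAlgebra.coeff_sum, Finsupp.finsetSum_apply, smul_eq_mul]
  simp only [coeff_of_mul]
  congr!

theorem of_mul_subgroupAvg (H : Subgroup G) {g : G} (hg : g ∈ H) :
    MonoidAlgebra.of ℂ G g * subgroupAvg H = subgroupAvg H := by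
  classical
  rw [subgroupAvg, mul_smul_comm, Finset.mul_sum]
  congr 1
  exact Fintype.sum_equiv (Equiv.mulLeft (⟨g, hg⟩ : H)) _ _ fun h => by rw [← map_mul]; rfl

theorem subgroupAvg_mul_of (H : Subgroup G) {g : G} (hg : g ∈ H) :
    subgroupAvg H * MonoidAlgebra.of ℂ G g = subgroupAvg H := by
  classical
  rw [subgroupAvg, smul_mul_assoc, Finset.sum_mul]
  congr 1
  exact Fintype.sum_equiv (Equiv.mulRight (⟨g, hg⟩ : H)) _ _ fun h => by rw [← map_mul]; rfl

theorem subgroupAvg_mul_self (H : Subgroup G) : subgroupAvg H * subgroupAvg H = subgroupAvg H := by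
  classical
  conv_lhs => lhs; rw [subgroupAvg]
  rw [smul_mul_assoc, Finset.sum_mul, Finset.sum_congr rfl fun h _ => of_mul_subgroupAvg H h.2,
    Finset.sum_const, Finset.card_univ, ← Nat.cast_smul_eq_nsmul ℂ, smul_smul,
    Nat.card_eq_fintype_card, inv_mul_cancel₀, one_smul]
  exact Nat.cast_ne_zero.2 Fintype.card_ne_zero

theorem coeff_subgroupAvg_mul_left (H : Subgroup G) (x : MonoidAlgebra ℂ G) {h : G} (hh : h ∈ H)
    (g : G) : (subgroupAvg H * x).coeff (h * g) = (subgroupAvg H * x).coeff g := by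
  conv_rhs => rw [← of_mul_subgroupAvg H (H.inv_mem hh), mul_assoc, coeff_of_mul, inv_inv]

theorem coeff_mul_subgroupAvg_right (H : Subgroup G) (x : MonoidAlgebra ℂ G) {h : G} (hh : h ∈ H)
    (g : G) : (x * subgroupAvg H).coeff (g * h) = (x * subgroupAvg H).coeff g := by
  conv_rhs => rw [← subgroupAvg_mul_of H (H.inv_mem hh), ← mul_assoc, coeff_mul_of, inv_inv]

theorem coeff_conjSum_mul_comm (c : MonoidAlgebra ℂ G) (a b : G) :
    (conjSum c).coeff (a * b) = (conjSum c).coeff (b * a) := by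
  have h := congrArg (fun x : MonoidAlgebra ℂ G => x.coeff b) (of_mul_conjSum c a⁻¹)
  simpa only [coeff_of_mul, coeff_mul_of, inv_inv] using h

end Average

/-- A permutation is conjugate to its inverse, and the coefficients of a sum of conjugates form a
class function. -/
theorem coeff_conjSum_inv {α : Type*} [Fintype α] [DecidableEq α] (c : MonoidAlgebra ℂ (Perm α))
    (g : Perm α) : (conjSum c).coeff g⁻¹ = (conjSum c).coeff g := by
  obtain ⟨u, hu⟩ := isConj_iff.1 (Perm.isConj_iff_cycleType_eq.2 (Perm.cycleType_inv g).symm)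
  rw [← hu, mul_assoc, coeff_conjSum_mul_comm, inv_mul_cancel_right]

/-! ### The Young symmetrizer of `2λ` has a component fixed by `H(n)` -/

/-- The permutation `c` acts on two halves exchanged by `τ`, and `τ` conjugates one restriction into
the other. The sign of `c` is therefore a square. -/
theorem sign_eq_one_of_commute {α : Type*} [Fintype α] [DecidableEq α] (c τ : Perm α)
    (p : α → Prop) [DecidablePred p] (hτ : ∀ i, p (τ i) ↔ ¬ p i) (hc : ∀ i, p (c i) ↔ p i)
    (hcomm : ∀ i, c (τ i) = τ (c i)) : Perm.sign c = 1 := by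
  have hc' : ∀ i, ¬ p (c i) ↔ ¬ p i := fun i => not_congr (hc i)
  have h1 : c = (c.subtypePerm hc).subtypeCongr (c.subtypePerm (p := fun i => ¬ p i) hc') := by
    ext i
    by_cases h : p i
    · rw [Perm.subtypeCongr.left_apply _ _ h]; rfl
    · rw [Perm.subtypeCongr.right_apply _ _ h]; rfl
  have h2 : Perm.sign (c.subtypePerm hc) = Perm.sign (c.subtypePerm (p := fun i => ¬ p i) hc') := by
    refine Perm.sign_eq_sign_of_equiv _ _ (τ.subtypeEquiv fun i => ?_) fun i => ?_
    · rw [hτ, not_not]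
    · exact Subtype.ext (hcomm i.1).symm
  rw [h1, Perm.sign_subtypeCongr, h2, Int.units_mul_self]

theorem mem_double {μ : YoungDiagram} {a b : ℕ} : (a, b) ∈ double μ ↔ (a, b / 2) ∈ μ := by
  rw [← YoungDiagram.mem_cells, double]
  simp only [Finset.mem_image, Finset.mem_product, Finset.mem_range, Prod.exists, Prod.mk.injEq,
    YoungDiagram.mem_cells]
  constructor
  · rintro ⟨i, j, e, ⟨h, he⟩, rfl, rfl⟩
    rwa [show (2 * j + e) / 2 = j by omega]
  · intro h
    exact ⟨a, b / 2, b % 2, ⟨h, by omega⟩, rfl, by omega⟩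

/-- The neighbour of a column in the pairs of columns `{2j, 2j + 1}`. -/
def pairedCol (b : ℕ) : ℕ := 2 * (b / 2) + (1 - b % 2)

theorem pairedCol_pairedCol (b : ℕ) : pairedCol (pairedCol b) = b := by
  unfold pairedCol; omega

section Paired

variable {α : Type*} [Fintype α] {μ : YoungDiagram}

omit [Fintype α] in
/-- The entries of a tableau of shape `2μ` are paired within the rows. -/
theorem exists_paired (T : α ≃ (double μ).cells) :
    ∃ τ : Perm α, (∀ i, rowOf T (τ i) = rowOf T i) ∧ (∀ i, colOf T (τ i) = pairedCol (colOf T i)) ∧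
      ∀ i, τ (τ i) = i := by
  have h : ∀ i, ∃ j, rowOf T j = rowOf T i ∧ colOf T j = pairedCol (colOf T i) := fun i => by
    refine exists_rowOf_colOf T ?_
    have := mem_double.1 (rowOf_colOf_mem T i)
    rwa [mem_double, show pairedCol (colOf T i) / 2 = colOf T i / 2 by unfold pairedCol; omega]
  choose f hf1 hf2 using h
  have hf : Function.Involutive f := fun i =>
    eq_of_rowOf_colOf T (by rw [hf1, hf1]) (by rw [hf2, hf2, pairedCol_pairedCol])
  exact ⟨hf.toPerm f, hf1, hf2, hf⟩

/-- In a nonzero term the column permutation $s^{-1}g$ commutes with `τ`, since both composites have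
the same row and the same column at every entry. It preserves the even columns, which `τ` exchanges
with the odd ones, so its sign is $1$. This is where the doubled shape enters. -/
theorem exists_nat_coeff_youngSymmetrizer [DecidableEq α] (T : α ≃ (double μ).cells) {τ : Perm α}
    (hr : ∀ i, rowOf T (τ i) = rowOf T i) (hc : ∀ i, colOf T (τ i) = pairedCol (colOf T i))
    {g : Perm α} (hg : ∀ i, g (τ i) = τ (g i)) : ∃ m : ℕ, (youngSymmetrizer T).coeff g = m := by
  rw [coeff_youngSymmetrizer]
  have key : ∀ s ∈ Finset.univ.filter (fun s : Perm α => ∀ i, rowOf T (s i) = rowOf T i),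
      (if ∀ i, colOf T ((s⁻¹ * g) i) = colOf T i then ((Perm.sign (s⁻¹ * g) : ℤ) : ℂ) else 0) =
        ((if ∀ i, colOf T ((s⁻¹ * g) i) = colOf T i then 1 else 0 : ℕ) : ℂ) := by
    intro s hs
    have hs' := (Finset.mem_filter.1 hs).2
    have hs2 : ∀ i, rowOf T (s⁻¹ i) = rowOf T i := fun i => by rw [← hs' (s⁻¹ i)]; simp
    split_ifs with h
    · rw [sign_eq_one_of_commute (s⁻¹ * g) τ (fun i => colOf T i % 2 = 0)]
      · simp
      · intro i
        rw [hc]; unfold pairedCol; omega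
      · intro i
        rw [h]
      · intro i
        refine eq_of_rowOf_colOf T ?_ ?_
        · rw [hr, Perm.mul_apply, Perm.mul_apply, hs2, hs2, hg, hr]
        · rw [h, hc, hc, h]
    · simp
  rw [Finset.sum_congr rfl key, ← Nat.cast_sum]
  exact ⟨_, rfl⟩

end Paired

/-- Choose $g$ carrying the base pairing to the pairing of neighbouring boxes. If the product
vanished, multiplying it by $g^{-1}c$ and removing the scalar $k^2$ would give $Eg^{-1}c=0$. But its
coefficient at $g^{-1}$ is the average of the coefficients of $c$ at the elements $gh^{-1}g^{-1}$,
which commute with that pairing: these are nonnegative integers, and the one at the identity is $1$.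
-/
theorem subgroupAvg_mul_conjSum_ne_zero {n : ℕ} {μ : YoungDiagram}
    (T : Letters n ≃ (double μ).cells) :
    subgroupAvg (hyperoctahedral n) * conjSum (youngSymmetrizer T) ≠ 0 := by
  classical
  intro h0
  have hT := isMinimalSymmetrizer_youngSymmetrizer T
  obtain ⟨τ, hr, hc, hτ⟩ := exists_paired T
  let y : Pairing n := ⟨τ, hτ, fun i hi => by
    have := hc i
    rw [hi] at this
    unfold pairedCol at this
    omega⟩
  obtain ⟨g, hg⟩ := exists_smul_basePairing y
  have hgτ : ∀ i, τ (g i) = g (flip n i) := fun i => by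
    have := smul_partner' g (basePairing n) i
    rw [hg] at this
    exact this
  have h1 : subgroupAvg (hyperoctahedral n) * (MonoidAlgebra.of ℂ _ g⁻¹ * youngSymmetrizer T) =
      0 := by
    have h2 : subgroupAvg (hyperoctahedral n) * (MonoidAlgebra.of ℂ _ g⁻¹ *
        (conjSum (youngSymmetrizer T) * youngSymmetrizer T)) = 0 := by
      rw [← mul_assoc (MonoidAlgebra.of ℂ _ g⁻¹), mul_conjSum, mul_assoc (conjSum _),
        ← mul_assoc, h0, zero_mul]
    rw [hT.conjSum_mul_self, mul_smul_comm, mul_smul_comm] at h2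
    exact (smul_eq_zero.1 h2).resolve_left (pow_ne_zero 2 hT.scalar_ne_zero)
  have h2 := congrArg (fun x : MonoidAlgebra ℂ _ => x.coeff g⁻¹) h1
  simp only [coeff_subgroupAvg_mul, coeff_of_mul, inv_inv, MonoidAlgebra.coeff_zero,
    Finsupp.zero_apply] at h2
  have h3 : ∀ h : hyperoctahedral n, ∃ m : ℕ,
      (youngSymmetrizer T).coeff (g * ((h : Perm (Letters n))⁻¹ * g⁻¹)) = m := by
    intro h
    refine exists_nat_coeff_youngSymmetrizer T hr hc fun i => ?_
    have hh : ∀ i, (h : Perm (Letters n))⁻¹ (flip n i) = flip n ((h : Perm (Letters n))⁻¹ i) :=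
      fun i => (congrArg (fun σ : Perm (Letters n) => σ i)
        (Subgroup.mem_centralizer_iff.1 ((hyperoctahedral n).inv_mem h.2) (flip n) rfl)).symm
    have hg' : g⁻¹ (τ i) = flip n (g⁻¹ i) := by
      rw [Perm.inv_eq_iff_eq, ← hgτ]; simp
    simp only [Perm.mul_apply]
    rw [hg', hh, hgτ]
  choose m hm using h3
  have h4 : m 1 = 1 := by
    have := hm 1
    rw [OneMemClass.coe_one, inv_one, one_mul, mul_inv_cancel, hT.coeff_one] at this
    exact_mod_cast this.symm
  simp only [hm] at h2
  rw [← Nat.cast_sum] at h2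
  have h5 := (mul_eq_zero.1 h2).resolve_left
    (inv_ne_zero (Nat.cast_ne_zero.2 Nat.card_pos.ne'))
  have h6 := Finset.single_le_sum (f := m) (fun i _ => Nat.zero_le _) (Finset.mem_univ 1)
  rw [Nat.cast_eq_zero.1 h5, h4] at h6
  omega

/-! ### Zonal spherical functions as elements of the group algebra -/

/-- Specht modules are built on permutations of the boxes, zonal functions on permutations of the
symbols; this is the transport between the two. -/
theorem coeff_youngSymmetrizer_permCongr {α : Type*} [Fintype α] [DecidableEq α]
    {μ : YoungDiagram} (T : α ≃ μ.cells) (g : Perm α) :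
    (youngSymmetrizer (Equiv.refl μ.cells)).coeff (T.permCongr g) =
      (youngSymmetrizer T).coeff g := by
  rw [coeff_youngSymmetrizer, coeff_youngSymmetrizer]
  have hrow : ∀ s : Perm α, (∀ i, rowOf (Equiv.refl μ.cells) (T.permCongr s i) =
      rowOf (Equiv.refl μ.cells) i) ↔ ∀ i, rowOf T (s i) = rowOf T i := fun s =>
    T.symm.forall_congr fun i => by simp [rowOf]
  have hcol : ∀ s : Perm α, (∀ i, colOf (Equiv.refl μ.cells) (T.permCongr s i) =
      colOf (Equiv.refl μ.cells) i) ↔ ∀ i, colOf T (s i) = colOf T i := fun s =>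
    T.symm.forall_congr fun i => by simp [colOf]
  refine (Finset.sum_equiv T.permCongr (fun s => ?_) fun s _ => ?_).symm
  · simp only [Finset.mem_filter, Finset.mem_univ, true_and, hrow]
  · have : (T.permCongr s)⁻¹ * T.permCongr g = T.permCongr (s⁻¹ * g) := by
      rw [inv_mul_eq_iff_eq_mul]
      ext i <;> simp
    rw [this, Perm.sign_permCongr]
    simp only [hcol]

theorem symmetrizer_eq (μ : YoungDiagram) :
    rowSymmetrizer μ * colAntisymmetrizer μ = youngSymmetrizer (Equiv.refl μ.cells) := by
  unfold rowSymmetrizer colAntisymmetrizer youngSymmetrizer stabSum stabAlt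
  congr!

theorem symmetrizerScalar_refl {α : Type*} [Fintype α] [DecidableEq α]
    {μ : YoungDiagram} (T : α ≃ μ.cells) :
    symmetrizerScalar (youngSymmetrizer (Equiv.refl μ.cells)) =
      symmetrizerScalar (youngSymmetrizer T) := by
  rw [symmetrizerScalar, symmetrizerScalar, coeff_mul_eq_sum, coeff_mul_eq_sum]
  refine (Fintype.sum_equiv T.permCongr _ _ fun u => ?_).symm
  rw [one_mul, one_mul, coeff_youngSymmetrizer_permCongr, ← coeff_youngSymmetrizer_permCongr T u⁻¹]
  congr 2

theorem coeff_conjSum_permCongr {α : Type*} [Fintype α] [DecidableEq α]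
    {μ : YoungDiagram} (T : α ≃ μ.cells) (g : Perm α) :
    (conjSum (youngSymmetrizer (Equiv.refl μ.cells))).coeff (T.permCongr g) =
      (conjSum (youngSymmetrizer T)).coeff g := by
  rw [coeff_conjSum, coeff_conjSum]
  refine (Fintype.sum_equiv T.permCongr _ _ fun u => ?_).symm
  rw [← coeff_youngSymmetrizer_permCongr]
  congr 1
  rw [mul_assoc, mul_assoc, eq_inv_mul_iff_mul_eq]
  ext i <;> simp

theorem character_spechtRep (μ : YoungDiagram) (g : Perm μ.cells) :
    (spechtRep μ).character g = (symmetrizerScalar (youngSymmetrizer (Equiv.refl μ.cells)))⁻¹ *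
      (conjSum (youngSymmetrizer (Equiv.refl μ.cells))).coeff g⁻¹ := by
  rw [← symmetrizer_eq]
  exact IsMinimalSymmetrizer.trace_restrict
    (symmetrizer_eq μ ▸ isMinimalSymmetrizer_youngSymmetrizer (Equiv.refl μ.cells)) g
    (fun v hv => mul_mem_spechtModule (μ := μ) (MonoidAlgebra.of ℂ (Perm μ.cells) g) hv)

theorem charDouble_eq {n : ℕ} (lam : Young n) (g : Perm (Letters n)) :
    charDouble lam g = (symmetrizerScalar (youngSymmetrizer (numbering lam)))⁻¹ *
      (conjSum (youngSymmetrizer (numbering lam))).coeff g := by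
  rw [charDouble, character_spechtRep, coeff_conjSum_inv, coeff_conjSum_permCongr,
    symmetrizerScalar_refl (numbering lam)]

/-- The scalar `k` of the Young symmetrizer of `2λ` satisfies `k · dim 2λ = |S(2n)|`. -/
theorem symmetrizerScalar_mul_dimDouble {n : ℕ} (lam : Young n) :
    symmetrizerScalar (youngSymmetrizer (numbering lam)) * dimDouble lam =
      Fintype.card (Perm (Letters n)) := by
  have h := (isMinimalSymmetrizer_youngSymmetrizer
    (Equiv.refl (double lam.1).cells)).scalar_mul_finrank
  rw [symmetrizerScalar_refl (numbering lam), ← symmetrizer_eq] at h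
  exact h.trans (congrArg Nat.cast (Fintype.card_congr (numbering lam).permCongr).symm)

/-- The zonal spherical function `w^λ` as an element of the group algebra. -/
def zonalElt {n : ℕ} (lam : Young n) : MonoidAlgebra ℂ (Perm (Letters n)) :=
  (symmetrizerScalar (youngSymmetrizer (numbering lam)))⁻¹ •
    (subgroupAvg (hyperoctahedral n) * conjSum (youngSymmetrizer (numbering lam)))

theorem zonal_eq_coeff {n : ℕ} (lam : Young n) (g : Perm (Letters n)) :
    zonal lam g = (zonalElt lam).coeff g := by
  classical
  rw [zonalElt, MonoidAlgebra.coeff_smul, Finsupp.smul_apply, coeff_subgroupAvg_mul, smul_eq_mul,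
    mul_left_comm, Finset.mul_sum, zonal]
  congr 1
  -- The definition averages over $gh$, the group algebra product over $h^{-1}g$; inversion in
  -- $H(n)$ and the class property match them.
  refine Finset.sum_bij' (fun h _ => h⁻¹) (fun h _ => h⁻¹) ?_ ?_ ?_ ?_ ?_
  · simp
  · simp
  · simp
  · simp
  · intro h _
    rw [charDouble_eq, coeff_conjSum_mul_comm]
    simp

/-- The scalar `|S(2n)| / dim 2λ`. -/
def zonalScalar {n : ℕ} (lam : Young n) : ℂ :=
  symmetrizerScalar (youngSymmetrizer (numbering lam))

theorem zonalScalar_ne_zero {n : ℕ} (lam : Young n) : zonalScalar lam ≠ 0 :=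
  (isMinimalSymmetrizer_youngSymmetrizer (numbering lam)).scalar_ne_zero

theorem zonalElt_ne_zero {n : ℕ} (lam : Young n) : zonalElt lam ≠ 0 :=
  smul_ne_zero (inv_ne_zero (zonalScalar_ne_zero lam)) (subgroupAvg_mul_conjSum_ne_zero _)

theorem double_injective : Function.Injective double := by
  intro μ ν h
  refine YoungDiagram.ext (Finset.ext fun ⟨a, b⟩ => ?_)
  have h1 : (a, 2 * b) ∈ double μ ↔ (a, 2 * b) ∈ double ν := by rw [h]
  rwa [mem_double, mem_double, show 2 * b / 2 = b by omega] at h1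

open scoped Classical in
-- Centrality of the conjugate sums brings the two averages together, where $E^2=E$, and leaves the
-- product of the two central elements.
theorem zonalElt_mul_zonalElt {n : ℕ} (lam mu : Young n) : zonalElt lam * zonalElt mu =
    if lam = mu then zonalScalar lam • zonalElt lam else 0 := by
  have h1 : zonalElt lam * zonalElt mu = (zonalScalar lam)⁻¹ • (zonalScalar mu)⁻¹ •
      (subgroupAvg (hyperoctahedral n) * (conjSum (youngSymmetrizer (numbering lam)) *
        conjSum (youngSymmetrizer (numbering mu)))) := by
    simp only [zonalElt, smul_mul_assoc, mul_smul_comm, zonalScalar]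
    rw [mul_assoc, ← mul_assoc (conjSum _), ← mul_conjSum, mul_assoc, ← mul_assoc (subgroupAvg _),
      subgroupAvg_mul_self, smul_comm]
  rw [h1]
  split_ifs with h
  · subst h
    rw [(isMinimalSymmetrizer_youngSymmetrizer (numbering lam)).conjSum_mul_conjSum,
      mul_smul_comm, zonalElt, ← zonalScalar]
    simp only [smul_smul]
    have := zonalScalar_ne_zero lam
    congr 1
    field_simp
  · rw [conjSum_mul_conjSum_of_ne _ _ fun h' => h (Subtype.ext (double_injective h')), mul_zero,
      smul_zero, smul_zero]

/-! ### Bi-invariance, symmetry under inversion and reality of the zonal functions -/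

theorem subgroupAvg_mul_zonalElt {n : ℕ} (lam : Young n) :
    subgroupAvg (hyperoctahedral n) * zonalElt lam = zonalElt lam := by
  rw [zonalElt, mul_smul_comm, ← mul_assoc, subgroupAvg_mul_self]

theorem zonalElt_mul_subgroupAvg {n : ℕ} (lam : Young n) :
    zonalElt lam * subgroupAvg (hyperoctahedral n) = zonalElt lam := by
  rw [zonalElt, smul_mul_assoc, mul_assoc, ← mul_conjSum, ← mul_assoc, subgroupAvg_mul_self]

theorem coeff_zonalElt_mul {n : ℕ} (lam : Young n) {h : Perm (Letters n)}
    (hh : h ∈ hyperoctahedral n) (g : Perm (Letters n)) :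
    (zonalElt lam).coeff (h * g) = (zonalElt lam).coeff g := by
  rw [← subgroupAvg_mul_zonalElt, coeff_subgroupAvg_mul_left _ _ hh]

theorem coeff_mul_zonalElt {n : ℕ} (lam : Young n) {h : Perm (Letters n)}
    (hh : h ∈ hyperoctahedral n) (g : Perm (Letters n)) :
    (zonalElt lam).coeff (g * h) = (zonalElt lam).coeff g := by
  rw [← zonalElt_mul_subgroupAvg, coeff_mul_subgroupAvg_right _ _ hh]

/-- The element $h^{-1}g^{-1}$ is inverse to $gh$, and the character takes the same value at both.
-/
theorem coeff_zonalElt_inv {n : ℕ} (lam : Young n) (g : Perm (Letters n)) :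
    (zonalElt lam).coeff g⁻¹ = (zonalElt lam).coeff g := by
  classical
  rw [← zonal_eq_coeff, zonalElt, MonoidAlgebra.coeff_smul, Finsupp.smul_apply,
    coeff_subgroupAvg_mul, smul_eq_mul, mul_left_comm, Finset.mul_sum, zonal]
  congr 1
  refine Finset.sum_congr rfl fun h _ => ?_
  rw [charDouble_eq, ← coeff_conjSum_inv, mul_inv_rev, inv_inv]

theorem zonalScalar_eq {n : ℕ} (lam : Young n) : 0 < dimDouble lam ∧
    zonalScalar lam = Fintype.card (Perm (Letters n)) / dimDouble lam := by
  have h := symmetrizerScalar_mul_dimDouble lam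
  have h1 : dimDouble lam ≠ 0 := fun h0 => by
    rw [h0, Nat.cast_zero, mul_zero] at h
    exact Fintype.card_ne_zero (Nat.cast_eq_zero.1 h.symm)
  exact ⟨Nat.pos_of_ne_zero h1, by rw [← h, zonalScalar, mul_div_cancel_right₀ _
    (Nat.cast_ne_zero.2 h1)]⟩

theorem conj_coeff_zonalElt {n : ℕ} (lam : Young n) (g : Perm (Letters n)) :
    (starRingEnd ℂ) ((zonalElt lam).coeff g) = (zonalElt lam).coeff g := by
  classical
  rw [zonalElt, MonoidAlgebra.coeff_smul, Finsupp.smul_apply, coeff_subgroupAvg_mul, smul_eq_mul,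
    ← zonalScalar, (zonalScalar_eq lam).2]
  simp only [coeff_conjSum, map_mul, map_inv₀, map_div₀, map_natCast, map_sum,
    conj_coeff_youngSymmetrizer]

/-! ### The orbits of `H(n)` on the pairings -/

theorem card_cellsOfRowLens (w : List ℕ) : (YoungDiagram.cellsOfRowLens w).card = w.sum := by
  induction w with
  | nil => simp [YoungDiagram.cellsOfRowLens]
  | cons a w ih =>
    rw [YoungDiagram.cellsOfRowLens, Finset.card_union_of_disjoint, Finset.card_map, ih,
      Finset.card_product, Finset.card_singleton, Finset.card_range, one_mul, List.sum_cons]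
    rw [Finset.disjoint_left]
    rintro ⟨i, j⟩ h1 h2
    simp only [Finset.mem_product, Finset.mem_singleton] at h1
    obtain ⟨c, -, hc⟩ := Finset.mem_map.1 h2
    have := congrArg Prod.fst hc
    simp [h1.1] at this

/-- The Young diagram whose rows are the parts of a partition. -/
def youngOfPartition {m : ℕ} (p : m.Partition) : Young m :=
  ⟨YoungDiagram.ofRowLens (p.parts.sort (· ≥ ·)) (p.parts.pairwise_sort _).sortedGE, by
    refine (card_cellsOfRowLens _).trans ?_
    rw [← Multiset.sum_coe, Multiset.sort_eq, p.parts_sum]⟩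

theorem youngOfPartition_injective {m : ℕ} :
    Function.Injective (youngOfPartition : m.Partition → Young m) := by
  intro p q h
  have key : ∀ p : m.Partition, (youngOfPartition p).1.rowLens = p.parts.sort (· ≥ ·) := fun p =>
    YoungDiagram.rowLens_ofRowLens_eq_self (hw := (p.parts.pairwise_sort _).sortedGE) fun x hx => p.parts_pos ((Multiset.mem_sort _).1 hx)
  have h1 := key p
  rw [h, key q] at h1
  refine Nat.Partition.ext ?_
  rw [← Multiset.sort_eq p.parts (· ≥ ·), ← Multiset.sort_eq q.parts (· ≥ ·), h1]

/-- The cycles of a pairing have even length, so that the symbols can be coloured with two colours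
alternating along each cycle. -/
theorem Pairing.exists_coloring {n : ℕ} (x : Pairing n) : ∃ ε : Letters n → Bool,
    (∀ i, ε (flip n i) = !ε i) ∧ ∀ i, ε (x.partner i) = !ε i := by
  induction n with
  | zero =>
    have := Fintype.card_eq_zero_iff.1 (card_letters 0)
    exact ⟨fun _ => true, fun i => this.elim i, fun i => this.elim i⟩
  | succ n ih =>
    classical
    obtain ⟨ε, h1, h2⟩ := ih (proj x)
    -- The symbol $n+1$ gets the colour opposite to its partner; if it is paired with $-(n+1)$ its
    -- colour is arbitrary, and `true` is chosen.
    let b : Bool := (code x).elim true fun a => !ε a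
    let δ : Letters (n + 1) → Bool := fun k =>
      if h : k.1 ∈ letters n then ε ⟨k.1, h⟩ else if k = top n then b else !b
    have d_incl : ∀ i, δ (incl i) = ε i := fun i => dif_pos i.2
    have d_top : δ (top n) = b :=
      (dif_neg ((not_mem_iff _).2 (Or.inl rfl))).trans (if_pos rfl)
    have d_bot : δ (flip (n + 1) (top n)) = !b :=
      (dif_neg ((not_mem_iff _).2 (Or.inr rfl))).trans (if_neg (flip_ne _))
    have hflip : ∀ k, δ (flip (n + 1) k) = !δ k := by
      intro k
      rcases letters_cases k with ⟨i, rfl⟩ | rfl | rfl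
      · rw [flip_incl, d_incl, d_incl, h1]
      · rw [d_bot, d_top]
      · rw [flip_flip, d_bot, d_top, Bool.not_not]
    have hsymm : ∀ k, δ (x.partner k) = !δ k → δ (x.partner (x.partner k)) = !δ (x.partner k) := by
      intro k hk
      rw [x.partner_partner, hk, Bool.not_not]
    have htop : δ (x.partner (top n)) = !δ (top n) := by
      rcases hc : code x with _ | a
      · rw [code_eq_none.1 hc, d_bot, d_top]
      · rw [code_eq_some.1 hc, d_incl, d_top]
        simp [b, hc]
    have hbot : δ (x.partner (flip (n + 1) (top n))) = !δ (flip (n + 1) (top n)) := by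
      rcases hc : code x with _ | a
      · have := hsymm _ htop
        rwa [code_eq_none.1 hc] at this
      · have ha := code_eq_some.1 hc
        have ha' : x.partner (incl a) = top n := by rw [← ha, x.partner_partner]
        rcases proj_cases x a with h | ⟨k, -, h, h'⟩
        · rw [ha'] at h; exact absurd h.symm (incl_ne_top _)
        · rw [ha'] at h; subst h
          rw [h', d_incl, h2, d_bot]
          simp [b, hc]
    refine ⟨δ, hflip, fun k => ?_⟩
    rcases letters_cases k with ⟨i, rfl⟩ | rfl | rfl
    · rcases proj_cases x i with h | ⟨k, hk, h, -⟩
      · rw [h, d_incl, d_incl, h2]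
      · have hk' : x.partner k = incl i := by rw [← h, x.partner_partner]
        have := hsymm k (by rcases hk with rfl | rfl <;> assumption)
        rwa [hk'] at this
    · exact htop
    · exact hbot

theorem card_coloring {n : ℕ} {ε : Letters n → Bool} (h : ∀ i, ε (flip n i) = !ε i) :
    Fintype.card {i // ε i = true} = n := by
  have h1 := Fintype.card_subtype_compl fun i => ε i = true
  have h2 : Fintype.card {i // ε i = true} = Fintype.card {i // ¬ ε i = true} :=
    Fintype.card_congr ((flip n).subtypeEquiv fun i => by rw [h]; simp)
  rw [← h2, card_letters] at h1
  have h3 := Fintype.card_subtype_le fun i => ε i = true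
  rw [card_letters] at h3
  omega

/-- Two pairings lie in the same orbit of `H(n)` if the permutations `i ↦ -partner i` of the symbols
of one colour are equivalent. -/
theorem exists_smul_eq_of_coloring {n : ℕ} {x y : Pairing n} {ε δ : Letters n → Bool}
    (hε : ∀ i, ε (flip n i) = !ε i) (hε' : ∀ i, ε (x.partner i) = !ε i)
    (hδ : ∀ i, δ (flip n i) = !δ i)
    (φ : {i // ε i = true} ≃ {i // δ i = true})
    (hφ : ∀ i j : {i // ε i = true}, j.1 = flip n (x.partner i.1) →
      (φ j).1 = flip n (y.partner (φ i).1)) :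
    ∃ h ∈ hyperoctahedral n, h • x = y := by
  classical
  have hf : ∀ i, ¬ ε i = true → ε (flip n i) = true := fun i hi => by
    rw [hε]; simpa using hi
  -- The equivalence on one colour class extends to the other in the only way compatible with
  -- $i\mapsto -i$.
  let f : Letters n → Letters n := fun i =>
    if hi : ε i = true then (φ ⟨i, hi⟩).1 else flip n (φ ⟨flip n i, hf i hi⟩).1
  have f_pos : ∀ i (hi : ε i = true), f i = (φ ⟨i, hi⟩).1 := fun i hi => dif_pos hi
  have f_flip : ∀ i, f (flip n i) = flip n (f i) := by
    have : ∀ i, ε i = true → f (flip n i) = flip n (f i) := by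
      intro i hi
      have hi' : ¬ ε (flip n i) = true := by rw [hε, hi]; simp
      rw [f_pos i hi]
      refine (dif_neg hi').trans ?_
      congr 3
      exact Subtype.ext (flip_flip i)
    intro i
    by_cases hi : ε i = true
    · exact this i hi
    · have := this (flip n i) (hf i hi)
      rw [flip_flip] at this
      rw [this, flip_flip]
  have f_col : ∀ i, δ (f i) = ε i := by
    intro i
    by_cases hi : ε i = true
    · rw [f_pos i hi, (φ _).2, hi]
    · have h1 := f_flip (flip n i)
      rw [flip_flip, f_pos _ (hf i hi)] at h1
      rw [h1, hδ, (φ _).2]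
      simpa using hi
  have f_inj : Function.Injective f := by
    have key : ∀ i j, ε i = true → f i = f j → i = j := by
      intro i j hi hij
      have hj : ε j = true := by rw [← f_col, ← hij, f_col, hi]
      rw [f_pos i hi, f_pos j hj] at hij
      exact Subtype.mk.inj (φ.injective (Subtype.ext hij))
    intro i j hij
    by_cases hi : ε i = true
    · exact key i j hi hij
    · refine (flip n).injective (key _ _ (hf i hi) ?_)
      rw [f_flip, f_flip, hij]
  let h : Perm (Letters n) := Equiv.ofBijective f (Finite.injective_iff_bijective.1 f_inj)
  have hh : ∀ i, h i = f i := fun _ => rfl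
  refine ⟨h, Subgroup.mem_centralizer_iff.2 fun g hg => ?_, ?_⟩
  · rw [Set.mem_singleton_iff.1 hg]
    exact Equiv.ext fun i => (f_flip i).symm
  · have key : ∀ i, ε i = true → f (x.partner i) = y.partner (f i) := by
      intro i hi
      have hj : ε (flip n (x.partner i)) = true := by rw [hε, hε', hi]; rfl
      have h1 := hφ ⟨i, hi⟩ ⟨_, hj⟩ rfl
      rw [← f_pos _ hj, ← f_pos _ hi, f_flip] at h1
      exact (flip n).injective h1
    refine Pairing.ext (funext fun k => ?_)
    obtain ⟨i, rfl⟩ := h.surjective k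
    rw [smul_partner', hh, hh]
    by_cases hi : ε i = true
    · exact key i hi
    · have hi' : ε (x.partner i) = true := by rw [hε']; simpa using hi
      have := key _ hi'
      rw [x.partner_partner] at this
      rw [this, y.partner_partner]

/-- The orbits of `H(n)` on `X(n)` are separated by Young diagrams with `n` boxes. -/
theorem exists_orbit_type (n : ℕ) : ∃ t : Pairing n → Young n,
    ∀ x y, t x = t y → ∃ h ∈ hyperoctahedral n, h • x = y := by
  classical
  choose ε hε hε' using fun x : Pairing n => x.exists_coloring
  -- Numbering the coloured symbols makes the permutations $i\mapsto-\mathrm{partner}\,i$ of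
  -- different pairings comparable. The diagram attached to a pairing is the cycle type of this
  -- permutation.
  let e : ∀ x, {i // ε x i = true} ≃ Fin n := fun x =>
    Fintype.equivFinOfCardEq (card_coloring (hε x))
  have hmem : ∀ x i, ε x i = true ↔ ε x (flip n (x.partner i)) = true := fun x i => by
    rw [hε, hε', Bool.not_not]
  let σ : ∀ x : Pairing n, Perm {i // ε x i = true} := fun x =>
    ((Function.Involutive.toPerm x.partner x.partner_partner).trans (flip n)).subtypeEquiv (hmem x)
  let t : Pairing n → Young n := fun x =>
    ⟨(youngOfPartition ((e x).permCongr (σ x)).partition).1,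
      (youngOfPartition ((e x).permCongr (σ x)).partition).2.trans (Fintype.card_fin n)⟩
  refine ⟨t, fun x y hxy => ?_⟩
  have h1 : ((e x).permCongr (σ x)).partition = ((e y).permCongr (σ y)).partition :=
    youngOfPartition_injective (Subtype.ext (Subtype.mk.inj hxy))
  obtain ⟨c, hc⟩ := isConj_iff.1 (Perm.partition_eq_of_isConj.2 h1)
  rw [mul_inv_eq_iff_eq_mul] at hc
  refine exists_smul_eq_of_coloring (hε x) (hε' x) (hε y)
    ((e x).trans (c.trans (e y).symm)) fun i j hij => ?_
  obtain rfl : j = σ x i := Subtype.ext hij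
  have h2 := congrArg (fun τ : Perm (Fin n) => (e y).symm (τ (e x i))) hc
  simp only [Perm.mul_apply, Equiv.permCongr_apply, Equiv.symm_apply_apply] at h2
  exact congrArg Subtype.val h2

/-! ### Expansion of bi-invariant functions in zonal spherical functions -/

theorem smul_basePairing_iff {n : ℕ} {g : Perm (Letters n)} :
    g • basePairing n = basePairing n ↔ g ∈ hyperoctahedral n := by
  have h1 : g • basePairing n = basePairing n ↔ ∀ i, g (flip n i) = flip n (g i) := by
    constructor
    · intro h i
      have := smul_partner' g (basePairing n) i
      rw [h] at this
      exact this.symm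
    · intro h
      refine Pairing.ext (funext fun k => ?_)
      obtain ⟨i, rfl⟩ := g.surjective k
      rw [smul_partner']
      exact h i
  rw [h1, hyperoctahedral, Subgroup.mem_centralizer_singleton_iff, Equiv.ext_iff]
  rfl

theorem exists_mul_mul_of_orbit {n : ℕ} {g g' h : Perm (Letters n)}
    (hh : h • g • basePairing n = g' • basePairing n) :
    ∃ k ∈ hyperoctahedral n, g' = h * g * k := by
  refine ⟨(h * g)⁻¹ * g', ?_, by group⟩
  rw [← smul_basePairing_iff, mul_smul, ← hh, ← mul_smul h g, inv_smul_smul]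

theorem coeff_sum_smul {G ι : Type*} [Group G] [Fintype ι] (d : ι → ℂ)
    (W : ι → MonoidAlgebra ℂ G) (g : G) :
    (∑ i, d i • W i).coeff g = ∑ i, d i * (W i).coeff g := by
  simp [MonoidAlgebra.coeff_sum, Finsupp.finsetSum_apply]

theorem sum_smul_zonalElt_mul {n : ℕ} (d : Young n → ℂ) (lam : Young n) :
    (∑ mu, d mu • zonalElt mu) * zonalElt lam = (d lam * zonalScalar lam) • zonalElt lam := by
  classical
  rw [Finset.sum_mul, Finset.sum_eq_single lam]
  · rw [smul_mul_assoc, zonalElt_mul_zonalElt, if_pos rfl, smul_smul]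
  · intro mu _ hne
    rw [smul_mul_assoc, zonalElt_mul_zonalElt, if_neg hne, smul_zero]
  · exact fun h => absurd (Finset.mem_univ _) h

/-- The zonal spherical functions span the functions that are bi-invariant under `H(n)`. -/
theorem exists_zonal_expansion {n : ℕ} (f : Perm (Letters n) → ℂ)
    (hl : ∀ h ∈ hyperoctahedral n, ∀ g, f (h * g) = f g)
    (hr : ∀ h ∈ hyperoctahedral n, ∀ g, f (g * h) = f g) :
    ∃ d : Young n → ℂ, ∀ g, f g = (∑ lam, d lam • zonalElt lam).coeff g := by
  classical
  obtain ⟨t, ht⟩ := exists_orbit_type n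
  -- A bi-invariant function factors through the orbit type. The value $0$ is used at diagrams that
  -- are not known to be types, since surjectivity of the type is not established.
  let lift : (Perm (Letters n) → ℂ) → Young n → ℂ := fun f l =>
    if h : ∃ g : Perm (Letters n), t (g • basePairing n) = l then f h.choose else 0
  have lift_eq : ∀ f : Perm (Letters n) → ℂ, (∀ h ∈ hyperoctahedral n, ∀ g, f (h * g) = f g) →
      (∀ h ∈ hyperoctahedral n, ∀ g, f (g * h) = f g) →
      ∀ g, lift f (t (g • basePairing n)) = f g := by
    intro f hl hr g
    have hex : ∃ g' : Perm (Letters n), t (g' • basePairing n) = t (g • basePairing n) := ⟨g, rfl⟩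
    refine (dif_pos hex).trans ?_
    obtain ⟨h, hh, hh'⟩ := ht _ _ hex.choose_spec
    obtain ⟨k, hk, hk'⟩ := exists_mul_mul_of_orbit hh'
    exact ((congrArg f hk').trans ((hr k hk _).trans (hl h hh _))).symm
  have hW : ∀ lam : Young n, ∀ g,
      lift (fun g => (zonalElt lam).coeff g) (t (g • basePairing n)) = (zonalElt lam).coeff g :=
    fun lam => lift_eq _ (fun h hh g => coeff_zonalElt_mul lam hh g)
      fun h hh g => coeff_mul_zonalElt lam hh g
  -- Multiplying a vanishing combination by one zonal element isolates its coefficient, by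
  -- orthogonality and the nonvanishing of that element.
  have hli : LinearIndependent ℂ fun lam : Young n => lift fun g => (zonalElt lam).coeff g := by
    rw [Fintype.linearIndependent_iff]
    intro d hd lam
    have h0 : ∑ mu, d mu • zonalElt mu = 0 := by
      refine MonoidAlgebra.ext (Finsupp.ext fun g => ?_)
      have := congrFun hd (t (g • basePairing n))
      simp only [Finset.sum_apply, Pi.smul_apply, hW, smul_eq_mul, Pi.zero_apply] at this
      rw [coeff_sum_smul, this]; rfl
    have h1 := sum_smul_zonalElt_mul d lam
    rw [h0, zero_mul] at h1
    exact (mul_eq_zero.1 ((smul_eq_zero.1 h1.symm).resolve_right (zonalElt_ne_zero lam))).resolve_right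
      (zonalScalar_ne_zero lam)
  -- There are as many independent functions as points of `Young n`, so they form a basis of all
  -- functions on it.
  have hspan := hli.span_eq_top_of_card_eq_finrank' (Module.finrank_fintype_fun_eq_card ℂ).symm
  obtain ⟨d, hd⟩ := (Submodule.mem_span_range_iff_exists_fun ℂ).1
    (hspan ▸ Submodule.mem_top : lift f ∈ _)
  refine ⟨d, fun g => ?_⟩
  have := congrFun hd (t (g • basePairing n))
  simp only [Finset.sum_apply, Pi.smul_apply, hW, smul_eq_mul, lift_eq f hl hr] at this
  rw [coeff_sum_smul, this]

/-! ### Multiplicity one and the value of the zonal functions at the identity -/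

/-- The vectors fixed by `H(n)` in the representation labelled by `2λ` form a line. -/
theorem exists_subgroupAvg_mul_mul_zonalElt {n : ℕ} (lam : Young n)
    (x : MonoidAlgebra ℂ (Perm (Letters n))) :
    ∃ a : ℂ, subgroupAvg (hyperoctahedral n) * x * zonalElt lam = a • zonalElt lam := by
  set E := subgroupAvg (hyperoctahedral n) with hE
  obtain ⟨d, hd⟩ := exists_zonal_expansion (fun g => (E * x * E).coeff g)
    (fun h hh g => by
      simp only [mul_assoc E]
      exact coeff_subgroupAvg_mul_left _ _ hh g)
    (fun h hh g => coeff_mul_subgroupAvg_right _ _ hh g)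
  refine ⟨d lam * zonalScalar lam, ?_⟩
  rw [← sum_smul_zonalElt_mul, ← MonoidAlgebra.ext (Finsupp.ext hd), mul_assoc _ E, hE,
    subgroupAvg_mul_zonalElt]

/-- The functional equation of spherical functions, in a form that does not presuppose
$w^\lambda(e)=1$. The scalar in $Euw=aw$ is found from the coefficient at the identity:
$a\,w(e)=w(u^{-1})=w(u)$. -/
theorem coeff_one_smul_subgroupAvg_mul {n : ℕ} (lam : Young n) (u : Perm (Letters n)) :
    (zonalElt lam).coeff 1 • (subgroupAvg (hyperoctahedral n) * MonoidAlgebra.of ℂ _ u *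
      zonalElt lam) = (zonalElt lam).coeff u • zonalElt lam := by
  obtain ⟨a, ha⟩ := exists_subgroupAvg_mul_mul_zonalElt lam (MonoidAlgebra.of ℂ _ u)
  have h1 := congrArg (fun x : MonoidAlgebra ℂ _ => x.coeff 1) ha
  simp only [MonoidAlgebra.coeff_smul, Finsupp.smul_apply, smul_eq_mul] at h1
  rw [mul_assoc, coeff_mul_one_comm, mul_assoc, zonalElt_mul_subgroupAvg, coeff_of_mul, mul_one,
    coeff_zonalElt_inv] at h1
  rw [ha, h1, smul_smul, mul_comm]

/-- This is $w*w=kw$ at the identity, using that $w$ is real and invariant under inversion. Its role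
is to fix the sign of $w(e)$. -/
theorem sum_coeff_zonalElt_sq {n : ℕ} (lam : Young n) :
    ∑ u, ((‖(zonalElt lam).coeff u‖ ^ 2 : ℝ) : ℂ) = zonalScalar lam * (zonalElt lam).coeff 1 := by
  classical
  have h := congrArg (fun x : MonoidAlgebra ℂ _ => x.coeff 1) (zonalElt_mul_zonalElt lam lam)
  simp only [if_pos, MonoidAlgebra.coeff_smul, Finsupp.smul_apply, smul_eq_mul, coeff_mul_eq_sum,
    one_mul] at h
  rw [← h]
  refine Finset.sum_congr rfl fun u _ => ?_
  rw [coeff_zonalElt_inv]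
  conv_rhs => rhs; rw [← conj_coeff_zonalElt]
  rw [Complex.mul_conj, Complex.normSq_eq_norm_sq]

/-- The central element $\sum_u uEu^{-1}$ acts on $w$ by a scalar $\theta$. Comparing coefficients
at the identity gives $\theta=k\,w(e)$; summing the functional equation over $u$ gives $w(e)\theta
w=w*w=kw$. Hence $k\,w(e)^2=k$. -/
theorem coeff_one_zonalElt_sq {n : ℕ} (lam : Young n) : (zonalElt lam).coeff 1 ^ 2 = 1 := by
  classical
  set E := subgroupAvg (hyperoctahedral n) with hE
  set c := youngSymmetrizer (numbering lam) with hc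
  have hmin : IsMinimalSymmetrizer c := isMinimalSymmetrizer_youngSymmetrizer _
  have hk := zonalScalar_ne_zero lam
  have hEc : E * conjSum c = zonalScalar lam • zonalElt lam := by
    rw [zonalElt, ← hE, ← hc, zonalScalar, ← hc, smul_smul, mul_inv_cancel₀ hmin.scalar_ne_zero,
      one_smul]
  obtain ⟨θ, hθ⟩ := hmin.exists_central_mul (mul_conjSum E)
  have h1 : θ = zonalScalar lam * (zonalElt lam).coeff 1 := by
    have h2 := congrArg (fun x : MonoidAlgebra ℂ _ => x.coeff 1) hθ
    rw [mul_conjSum, mul_conjSum_of_commute (mul_conjSum c), ← mul_conjSum, hEc, conjSum_smul,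
      MonoidAlgebra.coeff_smul, MonoidAlgebra.coeff_smul, Finsupp.smul_apply, Finsupp.smul_apply,
      hmin.conjSum_coeff_one, coeff_conjSum] at h2
    simp only [mul_one, inv_mul_cancel, Finset.sum_const, Finset.card_univ, nsmul_eq_mul,
      smul_eq_mul] at h2
    have hG : (Fintype.card (Perm (Letters n)) : ℂ) ≠ 0 := Nat.cast_ne_zero.2 Fintype.card_ne_zero
    apply mul_right_cancel₀ hG
    rw [← h2]; ring
  have h2 : conjSum E * zonalElt lam = θ • zonalElt lam := by
    have h3 : zonalScalar lam • (conjSum E * zonalElt lam) =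
        zonalScalar lam • θ • zonalElt lam := by
      rw [← mul_smul_comm, ← hEc, ← mul_assoc, ← mul_conjSum, mul_assoc, hθ, mul_smul_comm, hEc,
        smul_comm]
    exact smul_right_injective _ hk h3
  have h3 : (zonalElt lam).coeff 1 • (conjSum E * zonalElt lam) =
      zonalScalar lam • zonalElt lam := by
    have h4 := zonalElt_mul_zonalElt lam lam
    rw [if_pos rfl] at h4
    rw [← h4]
    conv_rhs => lhs; rw [← sum_coeff_smul_of (zonalElt lam)]
    rw [conjSum, Finset.sum_mul, Finset.sum_mul, Finset.smul_sum]
    refine Finset.sum_congr rfl fun u _ => ?_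
    rw [mul_assoc, mul_assoc, ← mul_assoc E, ← mul_smul_comm, coeff_one_smul_subgroupAvg_mul,
      coeff_zonalElt_inv, mul_smul_comm, smul_mul_assoc]
  rw [h2, smul_smul, h1] at h3
  have h5 := smul_left_injective _ (zonalElt_ne_zero lam) h3
  apply mul_left_cancel₀ hk
  rw [mul_one]
  exact Eq.trans (by ring) h5

/-- The value $-1$ is excluded because $k\,w(e)$ is a sum of squares and $k=|S(2n)|/\dim 2\lambda$
is positive. -/
theorem coeff_one_zonalElt {n : ℕ} (lam : Young n) : (zonalElt lam).coeff 1 = 1 := by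
  rcases mul_self_eq_one_iff.1 ((sq _).symm.trans (coeff_one_zonalElt_sq lam)) with h | h
  · exact h
  · exfalso
    have h1 := sum_coeff_zonalElt_sq lam
    obtain ⟨hd, hk⟩ := zonalScalar_eq lam
    rw [h, hk, ← Complex.ofReal_sum] at h1
    have h2 : (∑ u, ‖(zonalElt lam).coeff u‖ ^ 2 : ℝ) =
        -(Fintype.card (Perm (Letters n)) / dimDouble lam : ℝ) := by
      apply Complex.ofReal_injective
      rw [h1]
      push_cast
      ring
    have h3 : (0 : ℝ) ≤ ∑ u, ‖(zonalElt lam).coeff u‖ ^ 2 :=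
      Finset.sum_nonneg fun _ _ => sq_nonneg _
    have h4 : (0 : ℝ) < Fintype.card (Perm (Letters n)) / dimDouble lam :=
      div_pos (Nat.cast_pos.2 Fintype.card_pos) (Nat.cast_pos.2 hd)
    linarith

/-! ### The spherical function on `S(2n)` -/

/-- Averages over `X(n)` are averages over `S(2n)`. -/
theorem avg_pairing {n : ℕ} (F : Pairing n → ℂ) :
    (Fintype.card (Pairing n) : ℂ)⁻¹ * ∑ x, F x =
      (Fintype.card (Perm (Letters n)) : ℂ)⁻¹ * ∑ u : Perm (Letters n), F (u • basePairing n) := by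
  classical
  let N := (Finset.univ.filter fun u : Perm (Letters n) => u • basePairing n = basePairing n).card
  -- The action is transitive, so all fibres of the orbit map are translates of the stabilizer.
  have hN : ∀ x, (Finset.univ.filter fun u : Perm (Letters n) => u • basePairing n = x).card = N := by
    intro x
    obtain ⟨g, rfl⟩ := exists_smul_basePairing x
    refine (Finset.card_equiv (Equiv.mulLeft g) fun u => ?_).symm
    simp [mul_smul]
  have hF : ∀ F : Pairing n → ℂ, ∑ u : Perm (Letters n), F (u • basePairing n) = N * ∑ x, F x := by
    intro F
    rw [← Finset.sum_fiberwise Finset.univ fun u : Perm (Letters n) => u • basePairing n,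
      Finset.mul_sum]
    refine Finset.sum_congr rfl fun x _ => ?_
    rw [Finset.sum_congr rfl fun u hu => by rw [(Finset.mem_filter.1 hu).2], Finset.sum_const, hN,
      nsmul_eq_mul]
  have h1 := hF fun _ => 1
  simp only [Finset.sum_const, Finset.card_univ, nsmul_eq_mul, mul_one] at h1
  have hG : (Fintype.card (Perm (Letters n)) : ℂ) ≠ 0 := Nat.cast_ne_zero.2 Fintype.card_ne_zero
  rw [h1] at hG
  rw [hF, h1, mul_inv, mul_comm ((N : ℂ)⁻¹), mul_assoc, inv_mul_cancel_left₀ (left_ne_zero_of_mul hG)]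

/-- Integration of a function on `X` that depends on the projection to `X(n)`. -/
theorem integral_comp_p {t : ℝ} (ht : 0 < t) {n : ℕ} (F : Pairing n → ℂ) :
    ∫ x, F (x.p n) ∂ewens ht = ∑ y, (weight t y : ℂ) * F y := by
  rw [← integral_map (μ := ewens ht) (φ := XLim.p n) (f := F) (XLim.measurable_p n).aemeasurable
    (measurable_of_countable F).aestronglyMeasurable]
  have := Measure.isProbabilityMeasure_map (μ := ewens ht) (XLim.measurable_p n).aemeasurable
  rw [integral_fintype Integrable.of_finite]
  refine Finset.sum_congr rfl fun y _ => ?_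
  rw [Measure.real, Measure.map_apply (XLim.measurable_p n) (measurableSet_singleton y),
    ewens_cylinder, ENNReal.toReal_ofReal, Complex.real_smul]
  unfold weight
  positivity

theorem sum_weight {t : ℝ} (ht : 0 < t) (n : ℕ) : ∑ y : Pairing n, weight t y = 1 := by
  have h := integral_comp_p ht (n := n) fun _ => 1
  simp only [integral_const, probReal_univ, one_smul, mul_one] at h
  exact_mod_cast h.symm

/-- At $t=1$ all weights equal $1/(1\cdot3\cdots(2n-1))$, and they sum to $1$. -/
theorem card_pairing (n : ℕ) :
    (Fintype.card (Pairing n) : ℝ) = ∏ k ∈ Finset.range n, (2 * (k : ℝ) + 1) := by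
  have h := sum_weight one_pos n
  simp only [weight, one_pow, Finset.sum_const, Finset.card_univ, nsmul_eq_mul, one_div] at h
  have h0 : ∏ k ∈ Finset.range n, (1 + 2 * (k : ℝ)) ≠ 0 :=
    Finset.prod_ne_zero_iff.2 fun k _ => by positivity
  rw [mul_inv_eq_one₀ h0] at h
  rw [h]
  exact Finset.prod_congr rfl fun k _ => add_comm _ _

theorem sphericalFun_eq_sum {z : ℂ} (hz : z ≠ 0) {n : ℕ} (g : Perm (Letters n)) :
    sphericalFun hz (toS2inf n g) = ∑ x : Pairing n, (weight (‖z‖ ^ 2) x : ℂ) *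
      z ^ (((g • x).circles : ℤ) - x.circles) := by
  rw [← integral_comp_p (sq_norm_pos hz) fun x : Pairing n => z ^ (((g • x).circles : ℤ) - x.circles),
    sphericalFun, L2.inner_def]
  refine integral_congr_ae ?_
  have h1 : oneVec hz =ᵐ[ewens (sq_norm_pos hz)] fun _ => 1 := MemLp.coeFn_toLp _
  have h2 : repT hz (MulOpposite.op (toS2inf n g)) (oneVec hz) =ᵐ[ewens (sq_norm_pos hz)]
      twist z (toS2inf n g) fun _ => 1 :=
    (coeFn_opT hz (toS2inf n g) (oneVec hz)).trans (twist_congr hz _ h1)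
  filter_upwards [h1, h2] with x hx1 hx2
  have hs : Supported n (toS2inf n g : Perm ℤ) := supported_ofSubtype g
  rw [hx1, hx2, twist, cocycle_eq hs, XLim.p_smul hs, restr_toS2inf]
  simp

theorem sphericalFun_one {z : ℂ} (hz : z ≠ 0) (n : ℕ) :
    sphericalFun hz (toS2inf n 1) = 1 := by
  rw [sphericalFun_eq_sum]
  simp only [one_smul, sub_self, zpow_zero, mul_one]
  exact_mod_cast sum_weight (sq_norm_pos hz) n

/-- The weight contributes $t^{[x]}=z^{[x]}\bar z^{[x]}$, whose first factor cancels the $z^{-[x]}$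
of the cocycle. The square of the constant in `Fz` is $|X(n)|$ over the denominator of the weight.
-/
theorem sphericalFun_eq_innerX {z : ℂ} (hz : z ≠ 0) {n : ℕ} (g : Perm (Letters n)) :
    sphericalFun hz (toS2inf n g) = innerX (fun x => Fz z n (g • x)) (Fz z n) := by
  rw [sphericalFun_eq_sum, innerX, Finset.mul_sum]
  refine Finset.sum_congr rfl fun x _ => ?_
  have hP : (0 : ℝ) < ∏ k ∈ Finset.range n, (2 * (k : ℝ) + 1) :=
    Finset.prod_pos fun k _ => by positivity
  have ht := sq_norm_pos hz
  have hQ : (0 : ℝ) < ∏ k ∈ Finset.range n, (‖z‖ ^ 2 + 2 * (k : ℝ)) :=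
    Finset.prod_pos fun k _ => by positivity
  have hcard : (Fintype.card (Pairing n) : ℂ) =
      ((∏ k ∈ Finset.range n, (2 * (k : ℝ) + 1) : ℝ) : ℂ) := by
    rw [← card_pairing]; simp
  have hsq := Real.mul_self_sqrt (div_pos hP hQ).le
  unfold Fz weight
  rw [hcard]
  generalize ∏ k ∈ Finset.range n, (2 * (k : ℝ) + 1) = P at *
  generalize ∏ k ∈ Finset.range n, (‖z‖ ^ 2 + 2 * (k : ℝ)) = Q at *
  have hconj : ((‖z‖ ^ 2 : ℝ) : ℂ) = z * (starRingEnd ℂ) z := by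
    rw [Complex.mul_conj, Complex.normSq_eq_norm_sq]
  rw [zpow_sub₀ hz, zpow_natCast, zpow_natCast, map_mul, Complex.conj_ofReal, map_pow,
    Complex.ofReal_div, Complex.ofReal_pow, hconj, mul_pow]
  have hs : ((√(P / Q) : ℝ) : ℂ) * ((√(P / Q) : ℝ) : ℂ) = P / Q := by
    rw [← Complex.ofReal_mul, hsq, Complex.ofReal_div]
  have hP' : (P : ℂ) ≠ 0 := Complex.ofReal_ne_zero.2 hP.ne'
  have hQ' : (Q : ℂ) ≠ 0 := Complex.ofReal_ne_zero.2 hQ.ne'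
  have hzx : z ^ x.circles ≠ 0 := pow_ne_zero _ hz
  calc _ = (P : ℂ)⁻¹ * (P / Q) * z ^ (g • x).circles * (starRingEnd ℂ) z ^ x.circles := by
        field_simp
    _ = _ := by rw [← hs]; ring

/-! ### Zonal coefficients of $F_z^{(n)}$ and the expansion of the spherical function -/

theorem descend_zonal {n : ℕ} (lam : Young n) (u : Perm (Letters n)) :
    descend (zonal lam) (u • basePairing n) = (zonalElt lam).coeff u := by
  have h := (exists_smul_basePairing (u • basePairing n)).choose_spec
  rw [descend, zonal_eq_coeff]
  rw [← one_smul (Perm (Letters n)) (_ • basePairing n)] at h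
  obtain ⟨k, hk, hk'⟩ := exists_mul_mul_of_orbit h
  rw [one_mul] at hk'
  conv_rhs => rw [hk', coeff_mul_zonalElt lam hk]

/-- The convolution of a combination of zonal spherical functions with one of them. -/
theorem sum_coeff_mul_conj_zonalElt {n : ℕ} (d : Young n → ℂ) (lam : Young n)
    (g : Perm (Letters n)) :
    ∑ u, (∑ mu, d mu • zonalElt mu).coeff (g * u) * (starRingEnd ℂ) ((zonalElt lam).coeff u) =
      d lam * zonalScalar lam * (zonalElt lam).coeff g := by
  rw [← smul_eq_mul (d lam * zonalScalar lam), ← Finsupp.smul_apply, ← MonoidAlgebra.coeff_smul,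
    ← sum_smul_zonalElt_mul, coeff_mul_eq_sum]
  exact Finset.sum_congr rfl fun u _ => by rw [conj_coeff_zonalElt, coeff_zonalElt_inv]

/-- Left invariance holds because $H(n)$ preserves the number of cycles, right invariance because
$H(n)$ fixes the base pairing. -/
theorem exists_expansion_Fz (z : ℂ) (n : ℕ) : ∃ d : Young n → ℂ,
    ∀ u : Perm (Letters n), Fz z n (u • basePairing n) = (∑ lam, d lam • zonalElt lam).coeff u := by
  refine exists_zonal_expansion _ (fun h hh g => ?_) fun h hh g => ?_
  · rw [mul_smul, Fz, circles_smul hh, Fz]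
  · rw [mul_smul, smul_basePairing_iff.2 hh]

/-- Averaging over $S(2n)$ instead of $X(n)$, the inner product with $w^\lambda$ is the convolution
at the identity, $d_\lambda/\dim 2\lambda$; here $w^\lambda(e)=1$ is used. -/
theorem zMeasure_eq {z : ℂ} {n : ℕ} {d : Young n → ℂ}
    (hd : ∀ u : Perm (Letters n),
      Fz z n (u • basePairing n) = (∑ lam, d lam • zonalElt lam).coeff u) (lam : Young n) :
    zMeasure z lam = ‖d lam‖ ^ 2 / dimDouble lam := by
  obtain ⟨hdim, hk⟩ := zonalScalar_eq lam
  have h := sum_coeff_mul_conj_zonalElt d lam 1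
  simp only [one_mul, coeff_one_zonalElt, mul_one] at h
  have hG : (Fintype.card (Perm (Letters n)) : ℂ) ≠ 0 := Nat.cast_ne_zero.2 Fintype.card_ne_zero
  have h1 : innerX (Fz z n) (zonalNormalized lam) = (√(dimDouble lam : ℝ) : ℝ) *
      (d lam / dimDouble lam) := by
    rw [innerX, avg_pairing]
    simp only [hd, zonalNormalized, descend_zonal, map_mul, Complex.conj_ofReal]
    simp only [mul_left_comm _ ((√(dimDouble lam : ℝ) : ℝ) : ℂ)]
    rw [← Finset.mul_sum, h, hk]
    field_simp
  have hdim' : (0 : ℝ) < dimDouble lam := Nat.cast_pos.2 hdim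
  rw [zMeasure, h1, norm_mul, norm_div, Complex.norm_natCast, Complex.norm_real, Real.norm_eq_abs,
    mul_pow, sq_abs, Real.sq_sqrt hdim'.le]
  field_simp

theorem sphericalFun_eq_sum_zonal {z : ℂ} (hz : z ≠ 0) {n : ℕ} (g : Perm (Letters n)) :
    sphericalFun hz (toS2inf n g) = ∑ lam : Young n, (zMeasure z lam : ℂ) * zonal lam g := by
  obtain ⟨d, hd⟩ := exists_expansion_Fz z n
  rw [sphericalFun_eq_innerX, innerX, avg_pairing]
  simp only [← mul_smul, hd]
  -- Only the conjugated factor is expanded: convolving the whole first factor with a single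
  -- $w^\lambda$ selects $d_\lambda$, which meets its conjugate.
  have h : ∀ u, (starRingEnd ℂ) ((∑ lam, d lam • zonalElt lam).coeff u) =
      ∑ lam, (starRingEnd ℂ) (d lam) * (starRingEnd ℂ) ((zonalElt lam).coeff u) := fun u => by
    rw [coeff_sum_smul, map_sum]
    exact Finset.sum_congr rfl fun _ _ => map_mul _ _ _
  simp only [h, Finset.mul_sum]
  rw [Finset.sum_comm]
  refine Finset.sum_congr rfl fun lam _ => ?_
  have hG : (Fintype.card (Perm (Letters n)) : ℂ) ≠ 0 := Nat.cast_ne_zero.2 Fintype.card_ne_zero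
  obtain ⟨hdim, hk⟩ := zonalScalar_eq lam
  have hdim' : (dimDouble lam : ℂ) ≠ 0 := Nat.cast_ne_zero.2 hdim.ne'
  simp only [mul_left_comm _ ((starRingEnd ℂ) (d lam))]
  rw [← Finset.mul_sum, ← Finset.mul_sum, sum_coeff_mul_conj_zonalElt, hk, zonal_eq_coeff,
    zMeasure_eq hd, Complex.ofReal_div, ← Complex.normSq_eq_norm_sq, ← Complex.mul_conj,
    Complex.ofReal_natCast]
  field_simp

end GelfandZ

end

theorem mainTheorem2 {z : ℂ} (hz : z ≠ 0) (n : ℕ) :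
    (∀ g : Equiv.Perm (GelfandZ.Letters n),
      GelfandZ.sphericalFun hz (GelfandZ.toS2inf n g) =
        ∑ lam : GelfandZ.Young n, (GelfandZ.zMeasure z lam : ℂ) * GelfandZ.zonal lam g) ∧
    (∀ lam : GelfandZ.Young n, 0 ≤ GelfandZ.zMeasure z lam) ∧
    ∑ lam : GelfandZ.Young n, GelfandZ.zMeasure z lam = 1 := by
  refine ⟨GelfandZ.sphericalFun_eq_sum_zonal hz, fun lam => sq_nonneg _, ?_⟩
  -- At the identity the spherical function and every zonal function equal $1$, so the expansion is
  -- the statement about the total mass.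
  have h := GelfandZ.sphericalFun_eq_sum_zonal hz (n := n) 1
  simp only [GelfandZ.sphericalFun_one, GelfandZ.zonal_eq_coeff, GelfandZ.coeff_one_zonalElt,
    mul_one] at h
  exact_mod_cast h.symm
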